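/- Let $X$ be an infinite-dimensional complex Banach space and let $A$ be a closed densely defined linear operator in $X$ with domain $\mathcal D(A)$. Write $\sigma(A)=\{\lambda\in\mathbb C:\lambda-A\colon\mathcal D(A)\to X\text{ is not bijective}\}$. Call $A$ Fredholm if its range is closed and of finite codimension and its null space is finite-dimensional; Browder if it is Fredholm and $\mathcal N(A^n)=\mathcal N(A^{n+1})$, $\mathcal R(A^m)=\mathcal R(A^{m+1})$ for some $n,m\ge 0$. Let $\sigma_e(A)$, $\sigma_b(A)$ be the sets of $\lambda\in\mathbb C$ for which $A-\lambda$ is not Fredholm, respectively not Browder; the Riesz points of $A$ are the elements of $p_{00}(A)=\sigma(A)\setminus\sigma_b(A)$. A bounded operator $R$ on $X$ is Riesz if $\sigma_e(R)=\{0\}$. Let $\widehat{\mathcal C}(X)$ be the set of closed densely defined $A$ such that $\sigma_e(A)\ne\mathbb C$ and $\mathcal D(A^{j+1})=\mathcal D(A^j)$ for all sufficiently large $j$. $A$ is generalized Drazin-Riesz invertible if there is a bounded operator $B$ on $X$ with $\mathcal R(B)\subset\mathcal D(A)$, $\mathcal R(I-AB)\subset\mathcal D(A)$, $BAB=B$,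 $ABx=BAx$ for all $x\in\mathcal D(A)$, and $A(I-AB)$ bounded and Riesz. A bounded spectral set of $A$ is a bounded set $\sigma\subset\sigma(A)$ that is open and closed in $\sigma(A)\cup\{\infty\}\subset\mathbb C\cup\{\infty\}$; the spectral projection $P_\sigma$ is the bounded projection with null space $M$ and range $N$, where $X=M\oplus N$ with $M,N$ closed, $N\subset\mathcal D(A)$, $A(N)\subset N$, $A(M\cap\mathcal D(A))\subset M$, $\sigma(A|_M)=\sigma(A)\setminus\sigma$ and $\sigma(A|_N)=\sigma$. If $A$ is not invertible and $0\in\sigma$, the Drazin inverse of $A$ related to $\sigma$ is $A^{D,\sigma}=(A-\xi P_\sigma)^{-1}(I-P_\sigma)$ for some $\xi\in\mathbb C$ with $|\xi|>2\sup_{\lambda\in\sigma}|\lambda|$. **Theorem.** Let $(T(t))_{t\ge0}$ be a bounded $C_0$-semigroup on $X$ whose infinitesimal generator $A$ belongs to $\widehat{\mathcal C}(X)$, and suppose that $0$ is an accumulation point of $\sigma(A)$. Let $P\ne0$ be a bounded projection on $X$ such that (i) $T(t)P=PT(t)$ for all $t\ge0$; (ii) $\mathcal R(P)\subset\mathcal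 D(A)$; (iii) $\|T(t)(I-P)\|\to0$ as $t\to+\infty$; (iv) $\sigma(AP)=\{0,\mu_1,\mu_2,\dots\}$, where $(\mu_i)_{i\ge1}$ is a sequence in $p_{00}(A)\setminus\{0\}$ converging to $0$ such that $(|\mu_i|)_{i\ge1}$ is non-increasing and $|\mu_1|<\tfrac12$. Then $A$ is generalized Drazin-Riesz invertible, $A-P\colon\mathcal D(A)\to X$ has a bounded inverse, and there are a bounded projection $Q$ on $X$ and constants $M,\mu>0$ such that $\sigma(AQ)$ is a bounded spectral set of $A$ containing $0$, $Q$ is the spectral projection of $A$ relative to $\sigma(AQ)$, the Drazin inverse $A^{D,\sigma(AQ)}$ exists, $$\|T(t)(I-P)\|\le Me^{-\mu t}\qquad(t\ge0),$$ and $$A^{D,\sigma(AQ)}(I-P)=(A-P)^{-1}(I-P)=-\int_0^{\infty}T(t)(I-P)\,dt,$$ where the integral converges absolutely in the strong sense, that is, $t\mapsto T(t)(I-P)x$ is Bochner integrable on $(0,\infty)$ for every $x\in X$. -/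

import Mathlib

open Filter Topology MeasureTheory

namespace DrazinRiesz

section Algebraic

variable {E : Type*} [AddCommGroup E] [Module ℂ E]

/-- An everywhere defined linear operator, seen as an operator with domain. -/
def ofMap (B : E →ₗ[ℂ] E) : E →ₗ.[ℂ] E := B.toPMap ⊤

/-- The perturbation `A - B` of `A` by an everywhere defined `B`; its domain is that of `A`. -/
def subMap (A : E →ₗ.[ℂ] E) (B : E →ₗ[ℂ] E) : E →ₗ.[ℂ] E where
  domain := A.domain
  toFun := A.toFun - B ∘ₗ A.domain.subtype

/-- The operator `A - z` with the domain of `A`. -/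
def shift (A : E →ₗ.[ℂ] E) (z : ℂ) : E →ₗ.[ℂ] E := subMap A (z • LinearMap.id)

/-- The composition `x ↦ g (f x)` on its natural domain
`{x ∈ D(f) : f x ∈ D(g)}`. -/
def pcomp (g f : E →ₗ.[ℂ] E) : E →ₗ.[ℂ] E where
  domain :=
    { carrier := {x | ∃ h : x ∈ f.domain, f ⟨x, h⟩ ∈ g.domain}
      zero_mem' := ⟨f.domain.zero_mem, by
        have : f ⟨0, f.domain.zero_mem⟩ = 0 := f.map_zero
        rw [this]; exact g.domain.zero_mem⟩
      add_mem' := by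
        rintro x y ⟨hx, hx'⟩ ⟨hy, hy'⟩
        refine ⟨f.domain.add_mem hx hy, ?_⟩
        have : f ⟨x + y, f.domain.add_mem hx hy⟩ = f ⟨x, hx⟩ + f ⟨y, hy⟩ :=
          f.map_add ⟨x, hx⟩ ⟨y, hy⟩
        rw [this]; exact g.domain.add_mem hx' hy'
      smul_mem' := by
        rintro c x ⟨hx, hx'⟩
        refine ⟨f.domain.smul_mem c hx, ?_⟩
        have : f ⟨c • x, f.domain.smul_mem c hx⟩ = c • f ⟨x, hx⟩ :=
          f.map_smul c ⟨x, hx⟩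
        rw [this]; exact g.domain.smul_mem c hx' }
  toFun :=
    { toFun := fun x => g ⟨f ⟨x.1, x.2.1⟩, x.2.2⟩
      map_add' := by
        intro x y
        rw [← g.map_add]
        congr 1
        exact Subtype.ext (f.map_add ⟨x.1, x.2.1⟩ ⟨y.1, y.2.1⟩)
      map_smul' := by
        intro c x
        rw [RingHom.id_apply, ← g.map_smul]
        congr 1
        exact Subtype.ext (f.map_smul c ⟨x.1, x.2.1⟩) }

/-- The powers `A ^ n`, with domain `{x : x, A x, …, A ^ (n - 1) x ∈ D(A)}`. -/
def pow (A : E →ₗ.[ℂ] E) : ℕ → (E →ₗ.[ℂ] E)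
  | 0 => ofMap LinearMap.id
  | n + 1 => pcomp A (pow A n)

/-- The null space `N(A)`, as a subspace of the whole space. -/
def nullSpace (A : E →ₗ.[ℂ] E) : Submodule ℂ E :=
  (LinearMap.ker A.toFun).map A.domain.subtype

/-- The range `R(A)`. -/
def ran (A : E →ₗ.[ℂ] E) : Submodule ℂ E := LinearMap.range A.toFun

/-- The resolvent set `ρ(A)`. -/
def resolvent (A : E →ₗ.[ℂ] E) : Set ℂ := {z | Function.Bijective (shift A z).toFun}

/-- The spectrum `σ(A)`. -/
def spec (A : E →ₗ.[ℂ] E) : Set ℂ := (resolvent A)ᶜ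

/-- The part of `A` in a subspace `M`, as an operator in `M`, with domain
`{m ∈ M ∩ D(A) : A m ∈ M}`. It is the restriction of `A` to `M ∩ D(A)` as soon as
`A (M ∩ D(A)) ⊆ M`. -/
def part (A : E →ₗ.[ℂ] E) (M : Submodule ℂ E) : M →ₗ.[ℂ] M where
  domain :=
    { carrier := {m | ∃ h : (m : E) ∈ A.domain, A ⟨m, h⟩ ∈ M}
      zero_mem' := ⟨A.domain.zero_mem, by
        have : A ⟨((0 : M) : E), A.domain.zero_mem⟩ = 0 := A.map_zero
        rw [this]; exact M.zero_mem⟩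
      add_mem' := by
        rintro x y ⟨hx, hx'⟩ ⟨hy, hy'⟩
        refine ⟨A.domain.add_mem hx hy, ?_⟩
        have : A ⟨((x + y : M) : E), A.domain.add_mem hx hy⟩ = A ⟨x, hx⟩ + A ⟨y, hy⟩ :=
          A.map_add ⟨x, hx⟩ ⟨y, hy⟩
        rw [this]; exact M.add_mem hx' hy'
      smul_mem' := by
        rintro c x ⟨hx, hx'⟩
        refine ⟨A.domain.smul_mem c hx, ?_⟩
        have : A ⟨((c • x : M) : E), A.domain.smul_mem c hx⟩ = c • A ⟨x, hx⟩ :=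
          A.map_smul c ⟨x, hx⟩
        rw [this]; exact M.smul_mem c hx' }
  toFun :=
    { toFun := fun m => ⟨A ⟨m.1, m.2.1⟩, m.2.2⟩
      map_add' := by
        intro x y
        exact Subtype.ext (A.map_add ⟨x.1, x.2.1⟩ ⟨y.1, y.2.1⟩)
      map_smul' := by
        intro c x
        exact Subtype.ext (A.map_smul c ⟨x.1, x.2.1⟩) }

/-- The compactified spectrum `σ(A) ∪ {∞}` in the Riemann sphere. -/
def extSpec (A : E →ₗ.[ℂ] E) : Set (OnePoint ℂ) :=
  insert OnePoint.infty ((fun z : ℂ => (z : OnePoint ℂ)) '' spec A)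

/-- A subset of the compactified spectrum that is open and closed in its relative topology. -/
def IsSpectralSet (A : E →ₗ.[ℂ] E) (S : Set (OnePoint ℂ)) : Prop :=
  S ⊆ extSpec A ∧ IsClopen {z : extSpec A | (z : OnePoint ℂ) ∈ S}

/-- A bounded spectral set of `A`. -/
def IsBoundedSpectralSet (A : E →ₗ.[ℂ] E) (σ : Set ℂ) : Prop :=
  Bornology.IsBounded σ ∧ IsSpectralSet A ((fun z : ℂ => (z : OnePoint ℂ)) '' σ)

end Algebraic

section Normed

variable {X : Type*} [NormedAddCommGroup X] [NormedSpace ℂ X]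

/-- Fredholm operators: closed range, finite-dimensional null space, range of finite codimension. -/
def IsFredholm (A : X →ₗ.[ℂ] X) : Prop :=
  IsClosed (ran A : Set X) ∧ FiniteDimensional ℂ (nullSpace A) ∧
    FiniteDimensional ℂ (X ⧸ ran A)

def HasFiniteAscent (A : X →ₗ.[ℂ] X) : Prop :=
  ∃ n : ℕ, nullSpace (pow A n) = nullSpace (pow A (n + 1))

def HasFiniteDescent (A : X →ₗ.[ℂ] X) : Prop :=
  ∃ n : ℕ, ran (pow A n) = ran (pow A (n + 1))

def IsBrowder (A : X →ₗ.[ℂ] X) : Prop :=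
  IsFredholm A ∧ HasFiniteAscent A ∧ HasFiniteDescent A

/-- The essential spectrum. -/
def essSpec (A : X →ₗ.[ℂ] X) : Set ℂ := {z | ¬ IsFredholm (shift A z)}

/-- The Browder spectrum. -/
def browderSpec (A : X →ₗ.[ℂ] X) : Set ℂ := {z | ¬ IsBrowder (shift A z)}

/-- The set of Riesz points of `A`. -/
def rieszPoints (A : X →ₗ.[ℂ] X) : Set ℂ := spec A \ browderSpec A

/-- A bounded operator is Riesz if its essential spectrum is `{0}`. -/
def IsRiesz (R : X →L[ℂ] X) : Prop := essSpec (ofMap (R : X →ₗ[ℂ] X)) = {0}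

/-- Closed densely defined operators with nonempty essential resolvent set such that
`D(A ^ (j + 1)) = D(A ^ j)` for all sufficiently large `j`. -/
structure IsHatClosed (A : X →ₗ.[ℂ] X) : Prop where
  closed : A.IsClosed
  dense : Dense (A.domain : Set X)
  essResolvent : (essSpec A)ᶜ.Nonempty
  domains : ∀ᶠ j : ℕ in atTop, (pow A (j + 1)).domain = (pow A j).domain

/-- The product `A B` of `A` with a bounded operator `B`, on its natural domain
`{x : B x ∈ D(A)}`. -/
def mulBdd (A : X →ₗ.[ℂ] X) (B : X →L[ℂ] X) : X →ₗ.[ℂ] X := pcomp A (ofMap (B : X →ₗ[ℂ] X))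

/-- `B` is a generalized Drazin-Riesz inverse of `A`: the ranges of `B` and `I - A B` lie in
`D(A)`, `B A B = B`, `A B = B A` on `D(A)`, and `A (I - A B)` is bounded and Riesz. -/
structure IsGDRInverse (A : X →ₗ.[ℂ] X) (B : X →L[ℂ] X) : Prop where
  range_mem : ∀ x, B x ∈ A.domain
  sub_mem : ∀ x, x - A ⟨B x, range_mem x⟩ ∈ A.domain
  outer : ∀ x, B (A ⟨B x, range_mem x⟩) = B x
  comm : ∀ x : A.domain, B (A x) = A ⟨B x, range_mem x⟩
  riesz : ∃ R : X →L[ℂ] X, IsRiesz R ∧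
    ∀ x, R x = A ⟨x - A ⟨B x, range_mem x⟩, sub_mem x⟩

def IsGDRInvertible (A : X →ₗ.[ℂ] X) : Prop := ∃ B : X →L[ℂ] X, IsGDRInverse A B

/-- `(M, N) ∈ Red(A)`. -/
structure IsReduction (A : X →ₗ.[ℂ] X) (M N : Submodule ℂ X) : Prop where
  closed_left : IsClosed (M : Set X)
  closed_right : IsClosed (N : Set X)
  map_left : ∀ x : A.domain, (x : X) ∈ M → A x ∈ M
  le_domain : N ≤ A.domain
  map_right : ∀ x : A.domain, (x : X) ∈ N → A x ∈ N
  isCompl : IsCompl M N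

/-- `Q` is the spectral projection of `A` relative to the bounded spectral set `σ`: with
`M = N(Q)` and `N = R(Q)`, one has `(M, N) ∈ Red(A)`, `σ(A_M) = σ(A) \ σ` and `σ(A_N) = σ`. -/
structure IsSpectralProjection (A : X →ₗ.[ℂ] X) (σ : Set ℂ) (Q : X →L[ℂ] X) : Prop where
  spectralSet : IsBoundedSpectralSet A σ
  idem : IsIdempotentElem Q
  reduction : IsReduction A (LinearMap.ker (Q : X →ₗ[ℂ] X)) (LinearMap.range (Q : X →ₗ[ℂ] X))
  spec_ker : spec (part A (LinearMap.ker (Q : X →ₗ[ℂ] X))) = spec A \ σ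
  spec_range : spec (part A (LinearMap.range (Q : X →ₗ[ℂ] X))) = σ

/-- The bounded operator `C` is the inverse of `A`. -/
structure IsInverse (A : X →ₗ.[ℂ] X) (C : X →L[ℂ] X) : Prop where
  range_mem : ∀ y, C y ∈ A.domain
  right_inv : ∀ y, A ⟨C y, range_mem y⟩ = y
  left_inv : ∀ x : A.domain, C (A x) = x

/-- `D` is the Drazin inverse `A^{D,σ} = (A - ξ P_σ)⁻¹ (I - P_σ)` of the non-invertible operator
`A` related to the bounded spectral set `σ ∋ 0`, where `|ξ| > 2 sup {|z| : z ∈ σ}`. -/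
def IsDrazinInverse (A : X →ₗ.[ℂ] X) (σ : Set ℂ) (D : X →L[ℂ] X) : Prop :=
  0 ∈ spec A ∧ 0 ∈ σ ∧ ∃ S : X →L[ℂ] X, IsSpectralProjection A σ S ∧
    ∃ ξ : ℂ, 2 * sSup ((fun z : ℂ => ‖z‖) '' σ) < ‖ξ‖ ∧
      ∃ C : X →L[ℂ] X, IsInverse (subMap A ((ξ • S : X →L[ℂ] X) : X →ₗ[ℂ] X)) C ∧
        D = C.comp (ContinuousLinearMap.id ℂ X - S)

/-- `(T t)_{t ≥ 0}` is a `C₀`-semigroup; the values of `T` at negative times play no role. -/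
structure IsC0Semigroup (T : ℝ → X →L[ℂ] X) : Prop where
  zero : T 0 = ContinuousLinearMap.id ℂ X
  add : ∀ s t : ℝ, 0 ≤ s → 0 ≤ t → T (s + t) = (T s).comp (T t)
  strongCont : ∀ x : X, Tendsto (fun t => T t x) (𝓝[>] 0) (𝓝 x)

/-- `A` is the infinitesimal generator of `T`: `x ∈ D(A)` and `A x = y` if and only if
`(T t x - x) / t → y` as `t ↓ 0`. -/
def IsGenerator (T : ℝ → X →L[ℂ] X) (A : X →ₗ.[ℂ] X) : Prop :=
  ∀ x y : X, (x, y) ∈ A.graph ↔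
    Tendsto (fun t : ℝ => (t : ℂ)⁻¹ • (T t x - x)) (𝓝[>] 0) (𝓝 y)

end Normed

end DrazinRiesz

open DrazinRiesz

/-! The hypotheses force `A` to be bounded. Since `T(t)(I - P)` is a semigroup whose norm tends to
`0`, it decays exponentially (`exists_exp_bound`), so `J = ∫ T(t)(I - P) dt` is a bounded operator
with values in `N(P)` and `A J = -(I - P)` (`integral_orbit_mem_graph`). Thus `-J` is a right
inverse of `A` on `N(P)`. Stabilization of the domains `D(A^j)` then gives `N(P) ⊆ D(A)`
(`mem_domain_of_pow_domain_eq`); with `R(P) ⊆ D(A)` this makes `A` everywhere defined, hence a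
bounded `a` by the closed graph theorem.

What remains is algebra with commuting bounded operators. Invertibility of `a - z` on the range of a
projection `e` is encoded as `InvOn (a - z • 1) e`, which avoids restricted operators and contour
integrals. As `a` is invertible on `N(P)`, so is `a - z` for `|z| < r`. Only finitely many `μ i`
satisfy `|μ i| ≥ r`; removing their spectral idempotent `e`, built from kernels and ranges of
powers, gives `Q = P (1 - e)`, which carries the part of `σ(a)` in the disc of radius `r`
(`exists_projection_of_browder_sequence`, `isSpectralProjection_of_disc`).

The operator `a Q` is Riesz (`isRiesz_mul`): away from `0` it is a compression of a Fredholm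
operator or `a Q - z` is invertible, and at `0` it cannot be Fredholm, because `0` is a limit both
of its nonzero eigenvalues and of points of its resolvent set (`not_isFredholm_of_frequently`).
Finally `P J = Q J = 0`, so `a - P` and `a - ξ Q` both act as `a` on the range of `J`; their
inverses therefore agree with `-J` after composition with `I - P`. -/

namespace DrazinRiesz

/-! ### Invertibility on the corner of an idempotent. -/

section InvOn

variable {R : Type*} [Ring R]

/-- `c` is invertible on the corner determined by the idempotent `e`; for commuting operators this
says that `c` restricts to a bijection of the range of `e`. -/
def InvOn (c e : R) : Prop := ∃ d, c * d = e ∧ d * c = e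

theorem invOn_one {c : R} : InvOn c 1 ↔ IsUnit c := isUnit_iff_exists.symm

theorem InvOn.mono {c e f : R} (h : InvOn c e) (hfc : Commute f c) (hef : e * f = f) :
    InvOn c f := by
  obtain ⟨d, h1, h2⟩ := h
  refine ⟨d * f, by rw [← mul_assoc, h1, hef], ?_⟩
  rw [mul_assoc, hfc.eq, ← mul_assoc, h2, hef]

theorem InvOn.add {c e f : R} (he : InvOn c e) (hf : InvOn c f) : InvOn c (e + f) := by
  obtain ⟨d, h1, h2⟩ := he
  obtain ⟨d', h3, h4⟩ := hf
  exact ⟨d + d', by rw [mul_add, h1, h3], by rw [add_mul, h2, h4]⟩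

theorem InvOn.isUnit {c e : R} (h : InvOn c e) (h' : InvOn c (1 - e)) : IsUnit c := by
  have := h.add h'
  rwa [add_sub_cancel, invOn_one] at this

/-- Invertibility on a corner only depends on the corner part of the element. -/
theorem InvOn.congr {c c' e : R} (h : InvOn c e) (he : IsIdempotentElem e)
    (hc : c * e = c' * e) (hce' : Commute c' e) : InvOn c' e := by
  obtain ⟨d, h1, h2⟩ := h
  -- Both sides equal `d * c * d`, so a corner inverse commutes with `e` automatically.
  have hed : e * d = d * e := by rw [← h2, mul_assoc, h1, h2]
  refine ⟨d * e, ?_, ?_⟩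
  · rw [← hed, ← mul_assoc, ← hc, mul_assoc, hed, ← mul_assoc, h1, he.eq]
  · rw [mul_assoc, ← hce'.eq, ← hc, ← mul_assoc, h2, he.eq]

theorem IsUnit.invOn {c e : R} (h : IsUnit c) (hce : Commute c e) : InvOn c e :=
  (invOn_one.2 h).mono hce.symm (one_mul e)

/-- Allows each corner of `c` to be compared with a different, simpler element: typically `a - z` on
one side and a nonzero scalar or `a` itself on the other. -/
theorem InvOn.isUnit_of_corners {c c₁ c₂ e : R} (he : IsIdempotentElem e)
    (h₁ : InvOn c₁ e) (h₂ : InvOn c₂ (1 - e)) (hc : Commute c e) (h1 : c * e = c₁ * e)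
    (h2 : c * (1 - e) = c₂ * (1 - e)) : IsUnit c :=
  (h₁.congr he h1.symm hc).isUnit
    (h₂.congr he.one_sub h2.symm ((Commute.one_right _).sub_right hc))

theorem invOn_smul_one [Algebra ℂ R] {z : ℂ} (hz : z ≠ 0) (e : R) :
    InvOn (z • (1 : R)) e :=
  ⟨z⁻¹ • e, by simp [hz], by simp [hz]⟩

theorem commute_sub_smul_one [Algebra ℂ R] {a e : R} (h : Commute a e) (z : ℂ) :
    Commute (a - z • 1) e :=
  h.sub_left ((Commute.one_left e).smul_left z)

/-- Away from `0` the spectrum of `a e` is the spectrum of `a` on the corner of `e`. -/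
theorem isUnit_mul_sub_iff [Algebra ℂ R] {a e : R} (he : IsIdempotentElem e) (hae : Commute a e)
    {z : ℂ} (hz : z ≠ 0) : IsUnit (a * e - z • 1) ↔ InvOn (a - z • 1) e := by
  have hcomm : Commute (a * e) e := hae.mul_left (Commute.refl e)
  have h1 : (a * e - z • 1) * e = (a - z • 1) * e := by
    rw [sub_mul, sub_mul, mul_assoc, he.eq]
  constructor
  · intro h
    exact (IsUnit.invOn h (commute_sub_smul_one hcomm z)).congr he h1
      (commute_sub_smul_one hae z)
  · intro h
    refine InvOn.isUnit_of_corners he h (invOn_smul_one (neg_ne_zero.2 hz) _)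
      (commute_sub_smul_one hcomm z) h1 ?_
    rw [sub_mul, mul_assoc, mul_sub, mul_one, he.eq, sub_self, mul_zero, zero_sub, neg_smul,
      neg_mul]

/-- On the corner, `a - z` is the nonzero scalar `l - z` plus the nilpotent `a - l`. -/
theorem invOn_of_pow_mul_eq_zero [Algebra ℂ R] {a e : R} (he : IsIdempotentElem e)
    (hae : Commute a e) {l : ℂ} {k : ℕ} (hk : (a - l • 1) ^ k * e = 0) {z : ℂ} (hz : z ≠ l) :
    InvOn (a - z • 1) e := by
  have hc := commute_sub_smul_one hae l
  have hnil : IsNilpotent ((a - l • 1) * e) := by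
    refine ⟨k + 1, ?_⟩
    rw [hc.mul_pow, he.pow_succ_eq, pow_succ', mul_assoc, hk, mul_zero]
  have hu : IsUnit ((a - l • 1) * e + (l - z) • (1 : R)) := by
    refine hnil.isUnit_add_right_of_commute ?_ ((Commute.one_right _).smul_right _)
    exact invOn_one.1 (invOn_smul_one (sub_ne_zero.2 hz.symm) 1)
  have hcomm : Commute ((a - l • 1) * e + (l - z) • (1 : R)) e :=
    (hc.mul_left (Commute.refl e)).add_left ((Commute.one_left e).smul_left _)
  refine (IsUnit.invOn hu hcomm).congr he ?_ (commute_sub_smul_one hae z)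
  rw [add_mul, mul_assoc, he.eq, ← add_mul, sub_smul]
  congr 1
  abel

end InvOn

/-- Invertibility on a corner is stable under small scalar perturbations. -/
theorem InvOn.eventually {R : Type*} [NormedRing R] [NormedAlgebra ℂ R] [CompleteSpace R]
    {a e : R} (he : IsIdempotentElem e) (hae : Commute a e) (h : InvOn a e) :
    ∀ᶠ z : ℂ in 𝓝 0, InvOn (a - z • 1) e := by
  -- Padding `a` by the identity off the corner gives a unit of the whole ring, so openness of the
  -- units applies.
  have hc : Commute (a * e + (1 - e)) e :=
    (hae.mul_left (Commute.refl e)).add_left ((Commute.one_left e).sub_left (Commute.refl e))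
  have h1 : (a * e + (1 - e)) * e = a * e := by
    rw [add_mul, mul_assoc, he.eq, sub_mul, one_mul, he.eq, sub_self, add_zero]
  have hu : IsUnit (a * e + (1 - e)) := by
    refine InvOn.isUnit_of_corners he h (IsUnit.invOn isUnit_one (Commute.one_left _)) hc
      h1 ?_
    rw [add_mul, mul_assoc, mul_sub, mul_one, he.eq, sub_self, mul_zero, zero_add, one_mul,
      he.one_sub.eq]
  have hcont : ContinuousAt (fun z : ℂ => a * e + (1 - e) - z • (1 : R)) 0 := by fun_prop
  have hopen : {u : R | IsUnit u} ∈ 𝓝 (a * e + (1 - e) - (0 : ℂ) • (1 : R)) := by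
    rw [zero_smul, sub_zero]
    exact Units.isOpen.mem_nhds hu
  filter_upwards [hcont hopen] with z hz
  refine (IsUnit.invOn hz (commute_sub_smul_one hc z)).congr he ?_
    (commute_sub_smul_one hae z)
  rw [sub_mul, h1, sub_mul]

/-! ### Bounded operators: bounded inverses and closed ranges. -/

section Operators

variable {X : Type*} [NormedAddCommGroup X] [NormedSpace ℂ X] [CompleteSpace X]

/-- The set-theoretic description of invertibility on the range of a projection. -/
theorem invOn_iff_bijOn {c e : X →L[ℂ] X} (he : IsIdempotentElem e) (hce : Commute c e) :
    InvOn c e ↔ (∀ x, e x = x → c x = 0 → x = 0) ∧ ∀ y, e y = y → ∃ x, e x = x ∧ c x = y := by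
  have hcomm : ∀ x, c (e x) = e (c x) := fun x => congrArg (fun f : X →L[ℂ] X => f x) hce.eq
  have hee : ∀ x, e (e x) = e x := fun x => congrArg (fun f : X →L[ℂ] X => f x) he.eq
  constructor
  · rintro ⟨d, h1, h2⟩
    have h1' : ∀ x, c (d x) = e x := fun x => congrArg (fun f : X →L[ℂ] X => f x) h1
    have h2' : ∀ x, d (c x) = e x := fun x => congrArg (fun f : X →L[ℂ] X => f x) h2
    refine ⟨fun x hx h0 => ?_, fun y hy => ⟨d y, ?_, ?_⟩⟩
    · rw [← hx, ← h2', h0, map_zero]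
    · rw [← h2', h1', hy]
    · rw [h1', hy]
  · rintro ⟨hinj, hsurj⟩
    let N : Submodule ℂ X := LinearMap.ker ((1 - e : X →L[ℂ] X) : X →ₗ[ℂ] X)
    have hN : ∀ x, x ∈ N ↔ e x = x := fun x => by
      change x - e x = 0 ↔ _
      rw [sub_eq_zero, eq_comm]
    have hNc : IsClosed (N : Set X) := (1 - e : X →L[ℂ] X).isClosed_ker
    have : CompleteSpace N := hNc.completeSpace_coe
    have hcN : ∀ x : N, (c.comp N.subtypeL) x ∈ N := fun x => by
      rw [hN]
      simp only [ContinuousLinearMap.comp_apply, Submodule.subtypeL_apply]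
      rw [← hcomm, (hN _).1 x.2]
    let f : N →L[ℂ] N := (c.comp N.subtypeL).codRestrict N hcN
    have hf : ∀ x : N, (f x : X) = c x := fun x => rfl
    -- The range of `e` is closed, hence Banach, so the bijection has a bounded inverse.
    let g : N ≃L[ℂ] N := ContinuousLinearEquiv.ofBijective f
      (by
        rw [LinearMap.ker_eq_bot']
        intro x hx
        have hx' : f x = 0 := hx
        exact Subtype.ext (hinj x ((hN _).1 x.2) (by rw [← hf, hx']; rfl)))
      (by
        rw [LinearMap.range_eq_top]
        intro y
        obtain ⟨x, hx, hxy⟩ := hsurj y ((hN _).1 y.2)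
        exact ⟨⟨x, (hN _).2 hx⟩, Subtype.ext hxy⟩)
    have hg : ∀ x, g x = f x := fun x => rfl
    let p : X →L[ℂ] N := e.codRestrict N fun x => (hN _).2 (hee x)
    have hp : ∀ x, (p x : X) = e x := fun x => rfl
    refine ⟨N.subtypeL.comp ((g.symm : N →L[ℂ] N).comp p), ?_, ?_⟩
    · ext x
      change c (g.symm (p x) : X) = e x
      rw [← hf, ← hg, g.apply_symm_apply, hp]
    · ext x
      change (g.symm (p (c x)) : X) = e x
      have : p (c x) = g (p x) := Subtype.ext (by rw [hp, hg, hf, hp, hcomm])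
      rw [this, g.symm_apply_apply, hp]

/-- A bounded operator whose range has a closed algebraic complement has closed range. -/
theorem isClosed_range_of_isCompl {Y : Type*} [NormedAddCommGroup Y] [NormedSpace ℂ Y]
    [CompleteSpace Y] (f : X →L[ℂ] Y) (G : Submodule ℂ Y)
    (h : IsCompl (LinearMap.range (f : X →ₗ[ℂ] Y)) G) (hG : IsClosed (G : Set Y)) :
    IsClosed (LinearMap.range (f : X →ₗ[ℂ] Y) : Set Y) := by
  have : CompleteSpace G := hG.completeSpace_coe
  -- `φ` is surjective, hence a quotient map by the open mapping theorem, and the preimage of the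
  -- range of `f` is the closed set `X × {0}`.
  let φ : X × G →L[ℂ] Y := f.coprod G.subtypeL
  have hφ : ∀ p, φ p = f p.1 + p.2 := fun p => rfl
  have hsurj : Function.Surjective φ := by
    intro y
    obtain ⟨_, ⟨x, rfl⟩, g, hg, hy⟩ := Submodule.mem_sup.1
      (h.sup_eq_top ▸ Submodule.mem_top : y ∈ LinearMap.range (f : X →ₗ[ℂ] Y) ⊔ G)
    exact ⟨(x, ⟨g, hg⟩), hy⟩
  rw [← ((φ.isOpenMap hsurj).isQuotientMap φ.continuous hsurj).isClosed_preimage]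
  have : φ ⁻¹' (LinearMap.range (f : X →ₗ[ℂ] Y) : Set Y) = {p | p.2 = 0} := by
    ext ⟨x, g⟩
    change (f : X →ₗ[ℂ] Y) x + g ∈ LinearMap.range (f : X →ₗ[ℂ] Y) ↔ g = 0
    rw [Submodule.add_mem_iff_right _ (LinearMap.mem_range_self (f : X →ₗ[ℂ] Y) x)]
    refine ⟨fun hg => Subtype.ext (Submodule.disjoint_def.1 h.disjoint _ hg g.2), ?_⟩
    rintro rfl
    exact Submodule.zero_mem _
  rw [this]
  exact isClosed_eq continuous_snd continuous_const

end Operators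

/-! ### Everywhere defined operators, and kernels and ranges of powers. -/

section Algebraic

variable {E : Type*} [AddCommGroup E] [Module ℂ E]

theorem linearPMap_eq_of_domain_eq_top {A B : E →ₗ.[ℂ] E} (hA : A.domain = ⊤) (hB : B.domain = ⊤)
    (h : ∀ x (hx : x ∈ A.domain) (hx' : x ∈ B.domain), A ⟨x, hx⟩ = B ⟨x, hx'⟩) : A = B :=
  LinearPMap.ext (hA.trans hB.symm) fun x hx hx' => h x hx hx'

theorem subMap_ofMap (f g : E →ₗ[ℂ] E) : subMap (ofMap f) g = ofMap (f - g) :=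
  linearPMap_eq_of_domain_eq_top rfl rfl fun _ _ _ => rfl

theorem shift_ofMap (f : E →ₗ[ℂ] E) (z : ℂ) :
    shift (ofMap f) z = ofMap (f - z • LinearMap.id) := subMap_ofMap _ _

theorem pcomp_ofMap (f g : E →ₗ[ℂ] E) : pcomp (ofMap f) (ofMap g) = ofMap (f ∘ₗ g) :=
  linearPMap_eq_of_domain_eq_top (by ext x; exact ⟨fun _ => trivial, fun _ => ⟨trivial, trivial⟩⟩)
    rfl fun _ _ _ => rfl

theorem pow_ofMap (f : E →ₗ[ℂ] E) (n : ℕ) : pow (ofMap f) n = ofMap (f ^ n) := by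
  induction n with
  | zero => rfl
  | succ n ih => rw [pow, ih, pcomp_ofMap, pow_succ']; rfl

theorem nullSpace_ofMap (f : E →ₗ[ℂ] E) : nullSpace (ofMap f) = LinearMap.ker f := by
  ext x
  refine ⟨?_, fun h => ⟨⟨x, trivial⟩, h, rfl⟩⟩
  rintro ⟨y, hy, rfl⟩
  exact hy

theorem ran_ofMap (f : E →ₗ[ℂ] E) : ran (ofMap f) = LinearMap.range f := by
  ext x
  refine ⟨?_, ?_⟩
  · rintro ⟨y, rfl⟩
    exact ⟨y.1, rfl⟩
  · rintro ⟨y, rfl⟩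
    exact ⟨⟨y, trivial⟩, rfl⟩

theorem bijective_ofMap (f : E →ₗ[ℂ] E) :
    Function.Bijective (ofMap f).toFun ↔ Function.Bijective f := by
  constructor
  · rintro ⟨h1, h2⟩
    refine ⟨fun x y h => congrArg Subtype.val (@h1 ⟨x, trivial⟩ ⟨y, trivial⟩ h), fun y => ?_⟩
    obtain ⟨x, hx⟩ := h2 y
    exact ⟨x.1, hx⟩
  · rintro ⟨h1, h2⟩
    refine ⟨fun x y h => Subtype.ext (h1 h), fun y => ?_⟩
    obtain ⟨x, hx⟩ := h2 y
    exact ⟨⟨x, trivial⟩, hx⟩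

/-- An endomorphism whose `k`-th power has stable kernel and range splits the space. -/
theorem isCompl_ker_range_pow {f : E →ₗ[ℂ] E} {k : ℕ}
    (hker : LinearMap.ker (f ^ k) = LinearMap.ker (f ^ (k + k)))
    (hran : LinearMap.range (f ^ k) = LinearMap.range (f ^ (k + k))) :
    IsCompl (LinearMap.ker (f ^ k)) (LinearMap.range (f ^ k)) := by
  constructor
  · rw [Submodule.disjoint_def]
    rintro _ hx ⟨y, rfl⟩
    have : y ∈ LinearMap.ker (f ^ (k + k)) := by
      rw [pow_add]; exact hx
    rwa [← hker] at this
  · rw [codisjoint_iff, eq_top_iff]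
    intro x _
    obtain ⟨y, hy⟩ : (f ^ k) x ∈ LinearMap.range (f ^ (k + k)) := hran ▸ ⟨x, rfl⟩
    rw [pow_add] at hy
    refine Submodule.mem_sup.2 ⟨x - (f ^ k) y, ?_, (f ^ k) y, ⟨y, rfl⟩, sub_add_cancel _ _⟩
    rw [LinearMap.mem_ker, map_sub, ← hy, sub_eq_zero]; rfl

theorem range_pow_constant {f : E →ₗ[ℂ] E} {k : ℕ}
    (h : LinearMap.range (f ^ k) = LinearMap.range (f ^ (k + 1))) (m : ℕ) :
    LinearMap.range (f ^ k) = LinearMap.range (f ^ (k + m)) := by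
  induction m with
  | zero => rfl
  | succ m ih =>
    have e1 : f ^ (k + (m + 1)) = f * f ^ (k + m) := by rw [← pow_succ', add_assoc]
    have e2 : f ^ (k + 1) = f * f ^ k := pow_succ' f k
    rw [e1, Module.End.mul_eq_comp, LinearMap.range_comp, ← ih, ← LinearMap.range_comp,
      ← Module.End.mul_eq_comp, ← e2, h]

end Algebraic

/-! ### Spectra and spectral idempotents of bounded operators. -/

section Normed

variable {X : Type*} [NormedAddCommGroup X] [NormedSpace ℂ X]

theorem shift_ofMap_coe (a : X →L[ℂ] X) (z : ℂ) :
    shift (ofMap (a : X →ₗ[ℂ] X)) z = ofMap ((a - z • 1 : X →L[ℂ] X) : X →ₗ[ℂ] X) :=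
  shift_ofMap _ _

theorem mulBdd_ofMap (a b : X →L[ℂ] X) :
    mulBdd (ofMap (a : X →ₗ[ℂ] X)) b = ofMap ((a * b : X →L[ℂ] X) : X →ₗ[ℂ] X) :=
  pcomp_ofMap _ _

theorem isInverse_ofMap {a c : X →L[ℂ] X} (h1 : a * c = 1) (h2 : c * a = 1) :
    IsInverse (ofMap (a : X →ₗ[ℂ] X)) c where
  range_mem _ := trivial
  right_inv y := congrArg (fun f : X →L[ℂ] X => f y) h1
  left_inv x := congrArg (fun f : X →L[ℂ] X => f x.1) h2

variable [CompleteSpace X]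

theorem notMem_spec_ofMap (a : X →L[ℂ] X) (z : ℂ) :
    z ∉ spec (ofMap (a : X →ₗ[ℂ] X)) ↔ IsUnit (a - z • 1) := by
  rw [spec, Set.notMem_compl_iff, ContinuousLinearMap.isUnit_iff_bijective]
  change Function.Bijective _ ↔ _
  rw [shift_ofMap_coe, bijective_ofMap]
  rfl

theorem spec_ofMap (a : X →L[ℂ] X) : spec (ofMap (a : X →ₗ[ℂ] X)) = spectrum ℂ a := by
  ext z
  rw [← not_iff_not, notMem_spec_ofMap, spectrum.notMem_iff, Algebra.algebraMap_eq_smul_one,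
    ← IsUnit.neg_iff, neg_sub]

/-- The spectrum of the part of a bounded operator in the range of a commuting projection. -/
theorem notMem_spec_part {a e : X →L[ℂ] X} (he : IsIdempotentElem e) (hae : Commute a e)
    {N : Submodule ℂ X} (hN : ∀ x, x ∈ N ↔ e x = x) (z : ℂ) :
    z ∉ spec (part (ofMap (a : X →ₗ[ℂ] X)) N) ↔ InvOn (a - z • 1) e := by
  have haN : ∀ x : N, a x ∈ N := fun x => by
    rw [hN]
    have : a (e x) = e (a x) := congrArg (fun f : X →L[ℂ] X => f x) hae.eq
    rw [← this, (hN _).1 x.2]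
  have key : Function.Bijective (shift (part (ofMap (a : X →ₗ[ℂ] X)) N) z).toFun ↔
      (∀ x, e x = x → (a - z • 1) x = 0 → x = 0) ∧
        ∀ y, e y = y → ∃ x, e x = x ∧ (a - z • 1) x = y := by
    have hval : ∀ x : (shift (part (ofMap (a : X →ₗ[ℂ] X)) N) z).domain,
        ((shift (part (ofMap (a : X →ₗ[ℂ] X)) N) z).toFun x : X) = (a - z • 1) (x : N) :=
      fun x => rfl
    constructor
    · rintro ⟨h1, h2⟩
      refine ⟨fun x hx h0 => ?_, fun y hy => ?_⟩
      · have := (injective_iff_map_eq_zero _).1 h1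
          ⟨⟨x, (hN x).2 hx⟩, ⟨trivial, haN ⟨x, (hN x).2 hx⟩⟩⟩ (Subtype.ext (by rw [hval]; exact h0))
        exact congrArg Subtype.val (congrArg Subtype.val this)
      · obtain ⟨x, hx⟩ := h2 ⟨y, (hN y).2 hy⟩
        exact ⟨x.1, (hN _).1 x.1.2, by rw [← hval, hx]⟩
    · rintro ⟨h1, h2⟩
      refine ⟨(injective_iff_map_eq_zero _).2 fun x hx => ?_, fun y => ?_⟩
      · refine Subtype.ext (Subtype.ext (h1 _ ((hN _).1 x.1.2) ?_))
        rw [← hval, hx]; rfl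
      · obtain ⟨x, hx, hxy⟩ := h2 y ((hN _).1 y.2)
        exact ⟨⟨⟨x, (hN x).2 hx⟩, ⟨trivial, haN ⟨x, (hN x).2 hx⟩⟩⟩, Subtype.ext hxy⟩
  rw [spec, Set.notMem_compl_iff, invOn_iff_bijOn he (commute_sub_smul_one hae z), ← key]
  rfl

/-- The spectral idempotent of a bounded operator at a point where it is Browder. -/
theorem exists_idempotent_of_isBrowder {a : X →L[ℂ] X} {l : ℂ}
    (h : IsBrowder (shift (ofMap (a : X →ₗ[ℂ] X)) l)) :
    ∃ (e : X →L[ℂ] X) (k : ℕ), IsIdempotentElem e ∧ (∀ b, Commute a b → Commute e b) ∧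
      (a - l • 1) ^ k * e = 0 ∧ InvOn (a - l • 1) (1 - e) := by
  obtain ⟨-, ⟨n, hn⟩, ⟨m, hm⟩⟩ := h
  rw [shift_ofMap_coe] at hn hm
  simp only [pow_ofMap, nullSpace_ofMap, ran_ofMap] at hn hm
  set s : X →L[ℂ] X := a - l • 1 with hs
  set f : X →ₗ[ℂ] X := (s : X →ₗ[ℂ] X) with hf
  have hker : ∀ j ≥ n, LinearMap.ker (f ^ n) = LinearMap.ker (f ^ j) := fun j hj => by
    obtain ⟨i, rfl⟩ := Nat.exists_eq_add_of_le hj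
    exact Module.End.ker_pow_constant hn i
  have hran : ∀ j ≥ m, LinearMap.range (f ^ m) = LinearMap.range (f ^ j) := fun j hj => by
    obtain ⟨i, rfl⟩ := Nat.exists_eq_add_of_le hj
    exact range_pow_constant hm i
  -- One exponent past both ascent and descent: `X` is then the direct sum of the kernel and the
  -- range of `s ^ k`, both closed, and `e` projects onto the kernel.
  obtain ⟨k, hkn, hkm⟩ : ∃ k, n ≤ k ∧ m ≤ k := ⟨max n m, le_max_left _ _, le_max_right _ _⟩
  have hcompl : IsCompl (LinearMap.ker (f ^ k)) (LinearMap.range (f ^ k)) :=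
    isCompl_ker_range_pow ((hker k hkn).symm.trans (hker _ (by omega)))
      ((hran k hkm).symm.trans (hran _ (by omega)))
  have hpow : ((s ^ k : X →L[ℂ] X) : X →ₗ[ℂ] X) = f ^ k := by
    rw [hf]; exact ContinuousLinearMap.toLinearMap_pow s k
  rw [← hpow] at hcompl
  have hkc : IsClosed (LinearMap.ker ((s ^ k : X →L[ℂ] X) : X →ₗ[ℂ] X) : Set X) :=
    (s ^ k).isClosed_ker
  have hrc := isClosed_range_of_isCompl (s ^ k) _ hcompl.symm hkc
  have htop := Submodule.IsCompl.isTopCompl_of_isClosed hcompl hkc hrc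
  set e := Submodule.projectionL _ _ htop with he
  have hidem : IsIdempotentElem e := Submodule.isIdempotentElem_projectionL htop
  have hsk : ∀ x, (s ^ k) (e x) = 0 := fun x => Submodule.projectionL_apply_mem htop x
  have he0 : ∀ x, e x = 0 ↔ ∃ y, (s ^ k) y = x := fun x =>
    Submodule.projectionL_apply_eq_zero_iff htop
  have he1 : ∀ x, e x = x ↔ (s ^ k) x = 0 := fun x =>
    Submodule.projectionL_eq_self_iff htop x
  -- Anything commuting with `a` commutes with `s ^ k`, so it preserves both summands.
  have hcomm : ∀ b, Commute a b → Commute e b := by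
    intro b hb
    have hsb : Commute (s ^ k) b := (commute_sub_smul_one hb l).pow_left k
    have hsb' : ∀ x, (s ^ k) (b x) = b ((s ^ k) x) := fun x =>
      congrArg (fun f : X →L[ℂ] X => f x) hsb.eq
    refine ContinuousLinearMap.ext fun x => ?_
    change e (b x) = b (e x)
    have h1 : e (b (e x)) = b (e x) := by rw [he1, hsb', hsk, map_zero]
    have h2 : e (b (x - e x)) = 0 := by
      obtain ⟨y, hy⟩ := (he0 (x - e x)).1 (by
        rw [map_sub, sub_eq_zero]
        exact (congrArg (fun f : X →L[ℂ] X => f x) hidem.eq).symm)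
      rw [he0]
      exact ⟨b y, by rw [hsb', hy]⟩
    rw [map_sub, map_sub, sub_eq_zero] at h2
    rw [h2, h1]
  refine ⟨e, k, hidem, hcomm, ContinuousLinearMap.ext hsk, ?_⟩
  have hes : Commute e s := hcomm s (by
    rw [hs]; exact (Commute.refl a).sub_right ((Commute.one_right a).smul_right l))
  rw [invOn_iff_bijOn hidem.one_sub ((Commute.one_right s).sub_right hes.symm)]
  have h1e : ∀ x, (1 - e) x = x ↔ ∃ y, (s ^ k) y = x := fun x => by
    rw [← he0]
    change x - e x = x ↔ _
    rw [sub_eq_self]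
  have happ : ∀ j x, (s ^ j) x = (f ^ j) x := fun j x => by
    rw [hf, ← ContinuousLinearMap.toLinearMap_pow]; rfl
  -- On the range of `s ^ k`, `s` is injective because the kernels have stabilized and surjective
  -- because the ranges have.
  refine ⟨fun x hx h0 => ?_, fun y hy => ?_⟩
  · obtain ⟨y, rfl⟩ := (h1e x).1 hx
    have : y ∈ LinearMap.ker (f ^ (k + 1)) := by
      rw [LinearMap.mem_ker, ← happ, pow_succ']; exact h0
    rw [← hker (k + 1) (by omega), hker k hkn, LinearMap.mem_ker] at this
    rw [happ, this]
  · obtain ⟨w, rfl⟩ := (h1e y).1 hy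
    have : (f ^ k) w ∈ LinearMap.range (f ^ (k + 1)) := by
      rw [← hran (k + 1) (by omega), hran k hkm]; exact ⟨w, rfl⟩
    obtain ⟨v, hv⟩ := this
    refine ⟨(s ^ k) v, (h1e _).2 ⟨v, rfl⟩, ?_⟩
    rw [happ k w, ← hv, ← happ, pow_succ']; rfl

/-- The spectral idempotent of a bounded operator for a finite set of points where it is
Browder. -/
theorem exists_idempotent_of_finset {a : X →L[ℂ] X} (F : Finset ℂ)
    (h : ∀ l ∈ F, IsBrowder (shift (ofMap (a : X →ₗ[ℂ] X)) l)) :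
    ∃ e : X →L[ℂ] X, IsIdempotentElem e ∧ (∀ b, Commute a b → Commute e b) ∧
      (∀ z ∉ F, InvOn (a - z • 1) e) ∧ ∀ z ∈ F, InvOn (a - z • 1) (1 - e) := by
  classical
  induction F using Finset.induction_on with
  | empty =>
    refine ⟨0, IsIdempotentElem.zero, fun b _ => Commute.zero_left b, fun z _ => ⟨0, ?_, ?_⟩,
      ?_⟩ <;> simp
  | insert l F hl ih =>
    obtain ⟨e, he, hec, he1, he2⟩ := ih fun x hx => h x (Finset.mem_insert_of_mem hx)
    obtain ⟨g, k, hg, hgc, hg1, hg2⟩ :=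
      exists_idempotent_of_isBrowder (h l (Finset.mem_insert_self l F))
    have hae : Commute a e := (hec a (Commute.refl a)).symm
    have hag : Commute a g := (hgc a (Commute.refl a)).symm
    have heg : Commute e g := hec g hag
    have heg' : Commute (1 - e) (1 - g) :=
      ((Commute.one_left _).sub_left ((Commute.one_right e).sub_right heg))
    have hae' : Commute a (1 - e) := (Commute.one_right a).sub_right hae
    have hag' : Commute a (1 - g) := (Commute.one_right a).sub_right hag
    -- The join of the commuting idempotents `e` and `g`, which is also `e + g * (1 - e)`.
    refine ⟨1 - (1 - e) * (1 - g), (he.one_sub.mul_of_commute heg' hg.one_sub).one_sub,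
      fun b hb => ?_, fun z hz => ?_, fun z hz => ?_⟩
    · exact (Commute.one_left b).sub_left (((Commute.one_left b).sub_left (hec b hb)).mul_left
        ((Commute.one_left b).sub_left (hgc b hb)))
    · rw [Finset.mem_insert, not_or] at hz
      have h1 := he1 z hz.2
      have h2 := (invOn_of_pow_mul_eq_zero hg hag hg1 hz.1).mono (f := g * (1 - e))
        (commute_sub_smul_one (hag.mul_right hae') z).symm (by rw [← mul_assoc, hg.eq])
      have : 1 - (1 - e) * (1 - g) = e + g * (1 - e) := by
        rw [heg'.eq]; noncomm_ring
      rw [this]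
      exact h1.add h2
    · rw [sub_sub_cancel]
      have hc : Commute ((1 - e) * (1 - g)) (a - z • 1) :=
        (commute_sub_smul_one (hae'.mul_right hag') z).symm
      rcases Finset.mem_insert.1 hz with rfl | hz
      · exact hg2.mono hc (by rw [heg'.eq, ← mul_assoc, hg.one_sub.eq])
      · exact (he2 z hz).mono hc (by rw [← mul_assoc, he.one_sub.eq])

end Normed

/-! ### Fredholm operators and their ranges. -/

section Fredholm

variable {X : Type*} [NormedAddCommGroup X] [NormedSpace ℂ X] [CompleteSpace X]

theorem finiteDimensional_quotient_of_sup_eq_top {E : Type*} [AddCommGroup E] [Module ℂ E]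
    {p V : Submodule ℂ E} [FiniteDimensional ℂ V] (h : p ⊔ V = ⊤) :
    FiniteDimensional ℂ (E ⧸ p) := by
  refine Module.Finite.of_surjective (p.mkQ ∘ₗ V.subtype) fun y => ?_
  obtain ⟨x, rfl⟩ := p.mkQ_surjective y
  obtain ⟨u, hu, v, hv, rfl⟩ := Submodule.mem_sup.1 (h ▸ Submodule.mem_top : x ∈ p ⊔ V)
  refine ⟨⟨v, hv⟩, ?_⟩
  simp [hu]

theorem exists_finiteDimensional_isCompl {E : Type*} [AddCommGroup E] [Module ℂ E]
    (p : Submodule ℂ E) [FiniteDimensional ℂ (E ⧸ p)] :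
    ∃ V : Submodule ℂ E, FiniteDimensional ℂ V ∧ IsCompl p V := by
  obtain ⟨V, hV⟩ := p.exists_isCompl
  exact ⟨V, (p.quotientEquivOfIsCompl V hV).finiteDimensional, hV⟩

/-- A bounded operator between Banach spaces with range of finite codimension has closed range. -/
theorem isClosed_range_of_finiteDimensional_quotient (f : X →L[ℂ] X)
    [FiniteDimensional ℂ (X ⧸ LinearMap.range (f : X →ₗ[ℂ] X))] :
    IsClosed (LinearMap.range (f : X →ₗ[ℂ] X) : Set X) := by
  obtain ⟨V, hV, hc⟩ := exists_finiteDimensional_isCompl (LinearMap.range (f : X →ₗ[ℂ] X))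
  exact isClosed_range_of_isCompl f V hc V.closed_of_finiteDimensional

/-- If `R(f) + V` and `R(f ^ n) + W` are the whole space, applying `f` to the second shows that `R(f
^ (n + 1)) + f(W) + V` is too. -/
theorem finiteDimensional_quotient_range_pow {E : Type*} [AddCommGroup E] [Module ℂ E]
    (f : E →ₗ[ℂ] E) [FiniteDimensional ℂ (E ⧸ LinearMap.range f)] (n : ℕ) :
    FiniteDimensional ℂ (E ⧸ LinearMap.range (f ^ n)) := by
  obtain ⟨V, hV, hc⟩ := exists_finiteDimensional_isCompl (LinearMap.range f)
  suffices h : ∃ W : Submodule ℂ E, FiniteDimensional ℂ W ∧ LinearMap.range (f ^ n) ⊔ W = ⊤ by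
    obtain ⟨W, hW, h⟩ := h
    exact finiteDimensional_quotient_of_sup_eq_top h
  induction n with
  | zero => exact ⟨⊥, inferInstance, by rw [pow_zero, Module.End.one_eq_id]; simp⟩
  | succ n ih =>
    obtain ⟨W, hW, h⟩ := ih
    refine ⟨W.map f ⊔ V, inferInstance, ?_⟩
    rw [pow_succ', Module.End.mul_eq_comp, LinearMap.range_comp, ← sup_assoc, ← Submodule.map_sup,
      h, Submodule.map_top, hc.sup_eq_top]

theorem range_pow_antitone {E : Type*} [AddCommGroup E] [Module ℂ E] (f : E →ₗ[ℂ] E) :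
    Antitone fun n => LinearMap.range (f ^ n) := by
  refine antitone_nat_of_succ_le fun n => ?_
  rw [pow_succ]
  exact LinearMap.range_comp_le_range _ _

/-- An endomorphism with finite-dimensional kernel maps the intersection of the ranges of its
powers onto itself. -/
theorem exists_preimage_mem_iInf_range_pow {E : Type*} [AddCommGroup E] [Module ℂ E]
    (f : E →ₗ[ℂ] E) [FiniteDimensional ℂ (LinearMap.ker f)] {y : E}
    (hy : y ∈ ⨅ n, LinearMap.range (f ^ n)) : ∃ x ∈ ⨅ n, LinearMap.range (f ^ n), f x = y := by
  -- The traces of the ranges on the finite-dimensional kernel form a decreasing chain, constant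
  -- from some `N` on. Preimages of `y` in `R(f ^ N)` and in `R(f ^ n)` differ by a kernel vector,
  -- which for `n ≥ N` lies in `R(f ^ n)`; so one preimage serves every `n`.
  let K : ℕ →o (Submodule ℂ (LinearMap.ker f))ᵒᵈ :=
    ⟨fun n => OrderDual.toDual ((LinearMap.range (f ^ n)).comap (LinearMap.ker f).subtype),
      fun m n h => Submodule.comap_mono (range_pow_antitone f h)⟩
  obtain ⟨N, hN⟩ := IsArtinian.monotone_stabilizes K
  have hpre : ∀ n, ∃ x ∈ LinearMap.range (f ^ n), f x = y := fun n => by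
    obtain ⟨w, hw⟩ := (Submodule.mem_iInf _).1 hy (n + 1)
    rw [pow_succ'] at hw
    exact ⟨(f ^ n) w, ⟨w, rfl⟩, hw⟩
  obtain ⟨x, hx, hxy⟩ := hpre N
  refine ⟨x, (Submodule.mem_iInf _).2 fun n => ?_, hxy⟩
  rcases le_total n N with h | h
  · exact range_pow_antitone f h hx
  · obtain ⟨x', hx', hxy'⟩ := hpre n
    have hk : x - x' ∈ LinearMap.ker f := by rw [LinearMap.mem_ker, map_sub, hxy, hxy', sub_self]
    have h1 : (⟨x - x', hk⟩ : LinearMap.ker f) ∈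
        (LinearMap.range (f ^ N)).comap (LinearMap.ker f).subtype :=
      Submodule.sub_mem _ hx (range_pow_antitone f h hx')
    have h2 : (LinearMap.range (f ^ N)).comap (LinearMap.ker f).subtype =
        (LinearMap.range (f ^ n)).comap (LinearMap.ker f).subtype := hN n h
    rw [h2] at h1
    have h3 : x - x' ∈ LinearMap.range (f ^ n) := h1
    simpa using Submodule.add_mem _ h3 hx'

/-- The finite-dimensional kernel has a closed complement, on which `f` is an isomorphism. -/
theorem exists_rightInverse_of_surjective (f : X →L[ℂ] X) (hf : Function.Surjective f)
    [FiniteDimensional ℂ (LinearMap.ker (f : X →ₗ[ℂ] X))] : ∃ W : X →L[ℂ] X, f * W = 1 := by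
  obtain ⟨C, hCc, hC⟩ := (Submodule.ClosedComplemented.of_finiteDimensional
    (LinearMap.ker (f : X →ₗ[ℂ] X))).exists_isClosed_isCompl
  have : CompleteSpace C := hCc.completeSpace_coe
  let g : C →L[ℂ] X := f.comp C.subtypeL
  have hg : ∀ x : C, g x = f x := fun _ => rfl
  have h1 : LinearMap.ker (g : C →ₗ[ℂ] X) = ⊥ := by
    rw [LinearMap.ker_eq_bot']
    intro x hx
    exact Subtype.ext (Submodule.disjoint_def.1 hC.disjoint _ hx x.2)
  have h2 : LinearMap.range (g : C →ₗ[ℂ] X) = ⊤ := by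
    rw [LinearMap.range_eq_top]
    intro y
    obtain ⟨x, rfl⟩ := hf y
    obtain ⟨u, hu, v, hv, rfl⟩ := Submodule.mem_sup.1
      (hC.sup_eq_top ▸ Submodule.mem_top : x ∈ LinearMap.ker (f : X →ₗ[ℂ] X) ⊔ C)
    refine ⟨⟨v, hv⟩, ?_⟩
    change f v = f (u + v)
    have hu' : f u = 0 := hu
    rw [map_add, hu', zero_add]
  let G := ContinuousLinearEquiv.ofBijective g h1 h2
  refine ⟨C.subtypeL.comp (G.symm : X →L[ℂ] C), ?_⟩
  ext y
  exact G.apply_symm_apply y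

/-- Injectivity of a surjective operator with finite-dimensional kernel neither appears nor
disappears under small scalar perturbations. -/
theorem eventually_injective_sub_iff (f : X →L[ℂ] X) (hf : Function.Surjective f)
    [FiniteDimensional ℂ (LinearMap.ker (f : X →ₗ[ℂ] X))] :
    ∀ᶠ z : ℂ in 𝓝 0, Function.Injective (f - z • 1 : X →L[ℂ] X) ↔ Function.Injective f := by
  obtain ⟨W, hW⟩ := exists_rightInverse_of_surjective f hf
  have hcont : ContinuousAt (fun z : ℂ => (1 : X →L[ℂ] X) - z • W) 0 := by fun_prop
  have hopen : {u : X →L[ℂ] X | IsUnit u} ∈ 𝓝 ((1 : X →L[ℂ] X) - (0 : ℂ) • W) := by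
    rw [zero_smul, sub_zero]
    exact Units.isOpen.mem_nhds isUnit_one
  filter_upwards [hcont hopen] with z hz
  have hbij := ContinuousLinearMap.isUnit_iff_bijective.1 hz
  -- The second factor is bijective for small `z`, so `f - z` and `f` are injective together.
  have : f - z • 1 = f * (1 - z • W) := by rw [mul_sub, mul_one, mul_smul_comm, hW]
  rw [this]
  exact Function.Injective.of_comp_iff' f hbij

/-- If `0` is a limit both of points `z` where `f - z` is injective and of eigenvalues `z ≠ 0`,
then `f` is not Fredholm. -/
theorem not_isFredholm_of_frequently {f : X →L[ℂ] X}
    (h1 : ∃ᶠ z : ℂ in 𝓝 0, Function.Injective (f - z • 1 : X →L[ℂ] X))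
    (h2 : ∃ᶠ z : ℂ in 𝓝 0, z ≠ 0 ∧ ∃ x ≠ 0, f x = z • x) :
    ¬ IsFredholm (ofMap (f : X →ₗ[ℂ] X)) := by
  rintro ⟨-, hker, hcok⟩
  rw [nullSpace_ofMap] at hker
  rw [ran_ofMap] at hcok
  -- If `f` were Fredholm, it would map this closed hyperrange onto itself with finite-dimensional
  -- kernel. The first hypothesis makes `f` injective on `Y`, so small `z` are not eigenvalues
  -- there; yet eigenvectors for nonzero eigenvalues all lie in `Y`.
  let Y : Submodule ℂ X := ⨅ n, LinearMap.range ((f : X →ₗ[ℂ] X) ^ n)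
  have hYc : IsClosed (Y : Set X) := by
    rw [Submodule.coe_iInf]
    refine isClosed_iInter fun n => ?_
    have := finiteDimensional_quotient_range_pow (f : X →ₗ[ℂ] X) n
    rw [← ContinuousLinearMap.toLinearMap_pow] at this ⊢
    exact isClosed_range_of_finiteDimensional_quotient (f ^ n)
  have : CompleteSpace Y := hYc.completeSpace_coe
  have hfY : ∀ x : Y, (f.comp Y.subtypeL) x ∈ Y := fun x => by
    refine (Submodule.mem_iInf _).2 fun n => ?_
    obtain ⟨w, hw⟩ := (Submodule.mem_iInf _).1 x.2 n
    refine range_pow_antitone (f : X →ₗ[ℂ] X) n.le_succ ⟨w, ?_⟩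
    rw [pow_succ']
    exact congrArg f hw
  let g : Y →L[ℂ] Y := (f.comp Y.subtypeL).codRestrict Y hfY
  have hg : ∀ x : Y, (g x : X) = f x := fun _ => rfl
  have hsurj : Function.Surjective g := fun y => by
    obtain ⟨x, hx, hxy⟩ := exists_preimage_mem_iInf_range_pow (f : X →ₗ[ℂ] X) y.2
    exact ⟨⟨x, hx⟩, Subtype.ext hxy⟩
  have hfin : FiniteDimensional ℂ (LinearMap.ker (g : Y →ₗ[ℂ] Y)) := by
    let i : LinearMap.ker (g : Y →ₗ[ℂ] Y) →ₗ[ℂ] LinearMap.ker (f : X →ₗ[ℂ] X) :=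
      (Y.subtype ∘ₗ (LinearMap.ker (g : Y →ₗ[ℂ] Y)).subtype).codRestrict _ fun x =>
        congrArg Subtype.val (x.2 : g x.1 = 0)
    refine FiniteDimensional.of_injective i fun x y h => ?_
    have h' : ((x : Y) : X) = (y : Y) :=
      congrArg (LinearMap.ker (f : X →ₗ[ℂ] X)).subtype h
    exact Subtype.ext (Subtype.ext h')
  have hev := eventually_injective_sub_iff g hsurj
  have hinj : Function.Injective g := by
    obtain ⟨z, hz, hz'⟩ := (h1.and_eventually hev).exists
    refine hz'.1 fun x y h => Subtype.ext (hz ?_)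
    exact congrArg Subtype.val h
  obtain ⟨z, ⟨hz0, x, hx0, hx⟩, hz'⟩ := (h2.and_eventually hev).exists
  have hpow : ∀ n, ((f : X →ₗ[ℂ] X) ^ n) x = z ^ n • x := fun n => by
    induction n with
    | zero => simp
    | succ n ih =>
      rw [pow_succ, Module.End.mul_apply]
      change ((f : X →ₗ[ℂ] X) ^ n) (f x) = _
      rw [hx, map_smul, ih, smul_smul, pow_succ']
  have hxY : x ∈ Y := (Submodule.mem_iInf _).2 fun n => by
    refine ⟨(z ^ n)⁻¹ • x, ?_⟩
    rw [map_smul, hpow, smul_smul, inv_mul_cancel₀ (pow_ne_zero n hz0), one_smul]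
  refine hx0 (congrArg Subtype.val
    ((injective_iff_map_eq_zero _).1 (hz'.2 hinj) ⟨x, hxY⟩ (Subtype.ext ?_)))
  change f x - z • x = 0
  rw [hx, sub_self]

theorem isFredholm_of_isUnit {f : X →L[ℂ] X} (h : IsUnit f) :
    IsFredholm (ofMap (f : X →ₗ[ℂ] X)) := by
  obtain ⟨h1, h2⟩ := ContinuousLinearMap.isUnit_iff_bijective.1 h
  rw [IsFredholm, nullSpace_ofMap, ran_ofMap, LinearMap.range_eq_top.2 h2,
    LinearMap.ker_eq_bot.2 h1]
  exact ⟨isClosed_univ, inferInstance, inferInstance⟩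

end Fredholm

/-! ### Compression by a commuting projection. -/

section Compression

variable {X : Type*} [NormedAddCommGroup X] [NormedSpace ℂ X]

/-- Compression of a Fredholm operator to the range of a commuting projection. -/
theorem isFredholm_mul_sub {a e : X →L[ℂ] X} (he : IsIdempotentElem e) (hae : Commute a e)
    {z : ℂ} (hz : z ≠ 0) (h : IsFredholm (shift (ofMap (a : X →ₗ[ℂ] X)) z)) :
    IsFredholm (shift (ofMap ((a * e : X →L[ℂ] X) : X →ₗ[ℂ] X)) z) := by
  rw [shift_ofMap_coe] at h ⊢
  obtain ⟨hcl, hker, hcok⟩ := h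
  rw [IsFredholm]
  rw [nullSpace_ofMap] at hker ⊢
  rw [ran_ofMap] at hcl hcok ⊢
  have hcomm : ∀ x, a (e x) = e (a x) := fun x => congrArg (fun f : X →L[ℂ] X => f x) hae.eq
  have hee : ∀ x, e (e x) = e x := fun x => congrArg (fun f : X →L[ℂ] X => f x) he.eq
  have hle : LinearMap.ker ((a * e - z • 1 : X →L[ℂ] X) : X →ₗ[ℂ] X) ≤
      LinearMap.ker ((a - z • 1 : X →L[ℂ] X) : X →ₗ[ℂ] X) := by
    intro x hx
    have hx' : a (e x) - z • x = 0 := hx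
    rw [sub_eq_zero] at hx'
    have : e x = x := by
      have h1 : z • e x = z • x := by rw [← map_smul, ← hx', ← hcomm, hee]
      exact smul_right_injective X hz h1
    change a x - z • x = 0
    rw [← hx', this, sub_self]
  have hle' : LinearMap.range ((a - z • 1 : X →L[ℂ] X) : X →ₗ[ℂ] X) ≤
      LinearMap.range ((a * e - z • 1 : X →L[ℂ] X) : X →ₗ[ℂ] X) := by
    rintro _ ⟨x, rfl⟩
    -- On the range of `e` the operator is `a - z`, on the kernel it is `-z`; each component of `(a
    -- - z) x` is solved for separately.
    refine ⟨e x - z⁻¹ • ((a x - z • x) - e (a x - z • x)), ?_⟩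
    change a (e (e x - z⁻¹ • ((a x - z • x) - e (a x - z • x)))) -
      z • (e x - z⁻¹ • ((a x - z • x) - e (a x - z • x))) = a x - z • x
    simp only [map_sub, map_smul, hee, smul_sub, hcomm, smul_smul, mul_inv_cancel₀ hz,
      inv_mul_cancel₀ hz, one_smul]
    abel
  refine ⟨Submodule.isClosed_mono_of_finiteDimensional_quotient hcl hle',
    Submodule.finiteDimensional_of_le hle, ?_⟩
  exact Module.Finite.of_surjective (Submodule.factor hle') (Submodule.factor_surjective hle')

end Compression

/-! ### Decay and integration of semigroups. -/

section Semigroup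

variable {X : Type*} [NormedAddCommGroup X] [NormedSpace ℂ X]

theorem IsC0Semigroup.norm_sub_le {T : ℝ → X →L[ℂ] X} (hT : IsC0Semigroup T) {K : ℝ}
    (hK : ∀ t : ℝ, 0 ≤ t → ‖T t‖ ≤ K) (x : X) {s t : ℝ} (hs : 0 ≤ s) (ht : 0 ≤ t) :
    ‖T t x - T s x‖ ≤ K * ‖T |t - s| x - x‖ := by
  wlog hst : s ≤ t generalizing s t
  · rw [norm_sub_rev, abs_sub_comm]
    exact this ht hs (le_of_not_ge hst)
  have h : T t = (T s).comp (T |t - s|) := by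
    rw [← hT.add s _ hs (abs_nonneg _), abs_of_nonneg (sub_nonneg.2 hst), add_sub_cancel]
  rw [h, ContinuousLinearMap.comp_apply, ← map_sub]
  exact (T s).le_of_opNorm_le (hK s hs) _

/-- The uniform bound transports right continuity at `0` to every point, from both sides. -/
theorem IsC0Semigroup.continuousOn {T : ℝ → X →L[ℂ] X} (hT : IsC0Semigroup T) {K : ℝ}
    (hK : ∀ t : ℝ, 0 ≤ t → ‖T t‖ ≤ K) (x : X) :
    ContinuousOn (fun t => T t x) (Set.Ici 0) := by
  have h0 : Tendsto (fun t => T t x) (𝓝[≥] 0) (𝓝 x) := by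
    rw [← Set.Ioi_insert, nhdsWithin_insert, tendsto_sup]
    refine ⟨?_, hT.strongCont x⟩
    rw [tendsto_pure_left]
    intro s hs
    rw [hT.zero]
    exact mem_of_mem_nhds hs
  intro s hs
  have habs : Tendsto (fun t : ℝ => |t - s|) (𝓝[Set.Ici 0] s) (𝓝[≥] 0) := by
    refine tendsto_nhdsWithin_iff.2 ⟨?_, Eventually.of_forall fun t => Set.mem_Ici.2 (abs_nonneg _)⟩
    have : ContinuousAt (fun t : ℝ => |t - s|) s := by fun_prop
    have h := this.tendsto
    rw [sub_self, abs_zero] at h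
    exact h.mono_left nhdsWithin_le_nhds
  have h1 := ((h0.comp habs).sub_const x).norm.const_mul K
  rw [sub_self, norm_zero, mul_zero] at h1
  refine tendsto_iff_norm_sub_tendsto_zero.2 (squeeze_zero' (Eventually.of_forall fun t =>
    norm_nonneg _) ?_ h1)
  filter_upwards [self_mem_nhdsWithin] with t ht
  exact hT.norm_sub_le hK x hs ht

/-- A bounded operator semigroup whose norm tends to `0` decays exponentially. -/
theorem exists_exp_bound {S : ℝ → X →L[ℂ] X}
    (hadd : ∀ s t : ℝ, 0 ≤ s → 0 ≤ t → S (s + t) = (S s).comp (S t)) {K : ℝ}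
    (hK : ∀ t : ℝ, 0 ≤ t → ‖S t‖ ≤ K) (hlim : Tendsto (fun t => ‖S t‖) atTop (𝓝 0)) :
    ∃ M ν : ℝ, 0 < M ∧ 0 < ν ∧ ∀ t : ℝ, 0 ≤ t → ‖S t‖ ≤ M * Real.exp (-ν * t) := by
  obtain ⟨t₀, h1, ht₀⟩ : ∃ t₀, ‖S t₀‖ < Real.exp (-1) ∧ 0 < t₀ :=
    ((hlim.eventually_lt_const (Real.exp_pos (-1))).and (eventually_gt_atTop 0)).exists
  have hK0 : 0 ≤ K := (norm_nonneg _).trans (hK 0 le_rfl)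
  have hn : ∀ (n : ℕ) (r : ℝ), 0 ≤ r → ‖S (n * t₀ + r)‖ ≤ Real.exp (-n) * K := by
    intro n r hr
    induction n with
    | zero => simpa using hK r hr
    | succ n ih =>
      have e1 : ((n + 1 : ℕ) : ℝ) * t₀ + r = t₀ + (n * t₀ + r) := by push_cast; ring
      rw [e1, hadd _ _ ht₀.le (by positivity)]
      refine ((S t₀).opNorm_comp_le _).trans ?_
      calc ‖S t₀‖ * ‖S (n * t₀ + r)‖ ≤ Real.exp (-1) * (Real.exp (-n) * K) := by gcongr
        _ = Real.exp (-((n + 1 : ℕ) : ℝ)) * K := by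
          rw [← mul_assoc, ← Real.exp_add]; push_cast; ring_nf
  -- Each time step `t₀` gains a factor `exp (-1)`; `exp 1` pays for rounding `t / t₀` down, and `K
  -- + 1` keeps the constant positive when `K = 0`.
  refine ⟨Real.exp 1 * (K + 1), 1 / t₀, by positivity, by positivity, fun t ht => ?_⟩
  have hfl : (⌊t / t₀⌋₊ : ℝ) * t₀ ≤ t := by
    rw [← le_div_iff₀ ht₀]
    exact Nat.floor_le (by positivity)
  have h2 := hn ⌊t / t₀⌋₊ (t - ⌊t / t₀⌋₊ * t₀) (sub_nonneg.2 hfl)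
  rw [add_sub_cancel] at h2
  refine h2.trans ?_
  have h3 : Real.exp (-(⌊t / t₀⌋₊ : ℝ)) ≤ Real.exp 1 * Real.exp (-(1 / t₀) * t) := by
    rw [← Real.exp_add, Real.exp_le_exp]
    have := (Nat.lt_floor_add_one (t / t₀)).le
    have e : -(1 / t₀) * t = -(t / t₀) := by ring
    rw [e]
    linarith
  calc _ ≤ (Real.exp 1 * Real.exp (-(1 / t₀) * t)) * (K + 1) := by gcongr; linarith
    _ = _ := by ring

/-- The time integral of an exponentially bounded, strongly continuous family. -/
theorem exists_integral_operator {S : ℝ → X →L[ℂ] X}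
    (hcont : ∀ x, ContinuousOn (fun t => S t x) (Set.Ici 0)) {M ν : ℝ} (hν : 0 < ν)
    (hM : ∀ t : ℝ, 0 ≤ t → ‖S t‖ ≤ M * Real.exp (-ν * t)) :
    (∀ x, IntegrableOn (fun t => S t x) (Set.Ioi 0)) ∧
      ∃ J : X →L[ℂ] X, ∀ x, J x = ∫ t in Set.Ioi (0 : ℝ), S t x := by
  have hexp : IntegrableOn (fun t : ℝ => Real.exp (-ν * t)) (Set.Ioi 0) :=
    integrableOn_exp_mul_Ioi (by linarith) 0
  have hb : ∀ x, ∀ᵐ t ∂volume.restrict (Set.Ioi (0 : ℝ)),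
      ‖S t x‖ ≤ M * Real.exp (-ν * t) * ‖x‖ := fun x => by
    filter_upwards [ae_restrict_mem measurableSet_Ioi] with t ht
    exact (S t).le_of_opNorm_le (hM t (le_of_lt ht)) x
  have hmaj : ∀ x : X, Integrable (fun t : ℝ => M * Real.exp (-ν * t) * ‖x‖)
      (volume.restrict (Set.Ioi (0 : ℝ))) := fun x => (hexp.const_mul M).mul_const _
  have hintegr : ∀ x, IntegrableOn (fun t => S t x) (Set.Ioi 0) := fun x =>
    (hmaj x).mono' (((hcont x).mono Set.Ioi_subset_Ici_self).aestronglyMeasurable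
      measurableSet_Ioi) (hb x)
  refine ⟨hintegr, LinearMap.mkContinuous
    { toFun := fun x => ∫ t in Set.Ioi (0 : ℝ), S t x
      map_add' := fun x y => ?_
      map_smul' := fun c x => ?_ } (∫ t in Set.Ioi (0 : ℝ), M * Real.exp (-ν * t)) fun x => ?_,
    fun x => rfl⟩
  · simp only [map_add]
    exact integral_add (hintegr x) (hintegr y)
  · simp only [map_smul, RingHom.id_apply]
    exact integral_smul c _
  · rw [← integral_mul_const]
    exact norm_integral_le_of_norm_le (hmaj x) (hb x)

/-- Translation of the integrated orbit. -/
theorem integral_orbit_sub [CompleteSpace X] {T : ℝ → X →L[ℂ] X} (hT : IsC0Semigroup T) {y : X}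
    (hintegr : IntegrableOn (fun t => T t y) (Set.Ioi 0)) {h : ℝ} (hh : 0 ≤ h) :
    T h (∫ t in Set.Ioi (0 : ℝ), T t y) - ∫ t in Set.Ioi (0 : ℝ), T t y =
      - ∫ t in (0 : ℝ)..h, T t y := by
  have h1 : T h (∫ t in Set.Ioi (0 : ℝ), T t y) = ∫ t in Set.Ioi h, T t y := by
    rw [← ContinuousLinearMap.integral_comp_comm _ hintegr]
    have : ∫ t in Set.Ioi (0 : ℝ), T h (T t y) = ∫ t in Set.Ioi (0 : ℝ), T (t + h) y := by
      refine setIntegral_congr_fun measurableSet_Ioi fun t ht => ?_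
      have ht' : (0 : ℝ) ≤ t := le_of_lt ht
      change T h (T t y) = T (t + h) y
      rw [add_comm t h, hT.add h t hh ht', ContinuousLinearMap.comp_apply]
    rw [this]
    have := (measurePreserving_add_right volume h).setIntegral_preimage_emb
      (measurableEmbedding_addRight h) (fun t => T t y) (Set.Ioi h)
    rwa [Set.preimage_add_const_Ioi, sub_self] at this
  rw [h1, intervalIntegral.integral_of_le hh,
    ← Set.Ioc_union_Ioi_eq_Ioi hh, setIntegral_union (Set.Ioc_disjoint_Ioi le_rfl)
      measurableSet_Ioi (hintegr.mono_set Set.Ioc_subset_Ioi_self) (hintegr.mono_set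
      (Set.Ioi_subset_Ioi hh))]
  abel

/-- The integrated orbit lies in the domain of the generator. -/
theorem integral_orbit_mem_graph [CompleteSpace X] {T : ℝ → X →L[ℂ] X} (hT : IsC0Semigroup T)
    {A : X →ₗ.[ℂ] X} (hgen : IsGenerator T A) {y : X}
    (hcont : ContinuousOn (fun t => T t y) (Set.Ici 0))
    (hintegr : IntegrableOn (fun t => T t y) (Set.Ioi 0)) :
    (∫ t in Set.Ioi (0 : ℝ), T t y, -y) ∈ A.graph := by
  rw [hgen]
  -- Translating the orbit integral by `h` only removes its piece over `(0, h]`, so the difference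
  -- quotient is minus the mean of the orbit there, which tends to `-y`.
  have hderiv : HasDerivWithinAt (fun u => ∫ t in (0 : ℝ)..u, T t y) (T 0 y) (Set.Ioi 0) 0 := by
    refine (intervalIntegral.integral_hasDerivWithinAt_right (s := Set.Ici 0) (t := Set.Ioi 0)
      (by simp) ⟨Set.Ioi 0, self_mem_nhdsWithin, hintegr.1⟩ ?_).mono Set.Ioi_subset_Ici_self
    exact (hcont 0 Set.self_mem_Ici).mono Set.Ioi_subset_Ici_self
  rw [hasDerivWithinAt_iff_tendsto_slope' (by simp), hT.zero] at hderiv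
  refine hderiv.neg.congr' ?_
  filter_upwards [self_mem_nhdsWithin] with h hh
  rw [integral_orbit_sub hT hintegr (le_of_lt hh), slope_def_module]
  simp only [intervalIntegral.integral_same, sub_zero, smul_neg]
  rw [← Complex.ofReal_inv, Complex.coe_smul]

end Semigroup

/-! ### From stabilizing domains to boundedness. -/

section Domain

theorem mem_graph_pcomp {E : Type*} [AddCommGroup E] [Module ℂ E] {f g : E →ₗ.[ℂ] E} {x y z : E}
    (hf : (x, y) ∈ f.graph) (hg : (y, z) ∈ g.graph) : (x, z) ∈ (pcomp g f).graph := by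
  obtain ⟨⟨x, hx⟩, rfl, rfl⟩ := (LinearPMap.mem_graph_iff _).1 hf
  obtain ⟨w, hw1, hw2⟩ := (LinearPMap.mem_graph_iff _).1 hg
  have hw1' : (w : E) = f ⟨x, hx⟩ := hw1
  refine (LinearPMap.mem_graph_iff _).2 ⟨⟨x, ⟨hx, hw1' ▸ w.2⟩⟩, rfl, ?_⟩
  exact (congrArg g (Subtype.ext hw1'.symm)).trans hw2

/-- If `A` has a right inverse `J` on a subspace and the domains of the powers of `A` stabilize,
that subspace lies in the domain of `A`. -/
theorem mem_domain_of_pow_domain_eq {E : Type*} [AddCommGroup E] [Module ℂ E] {A : E →ₗ.[ℂ] E}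
    {J : E →ₗ[ℂ] E} {M : Submodule ℂ E} (hJM : ∀ x ∈ M, J x ∈ M)
    (hJ : ∀ x ∈ M, (J x, x) ∈ A.graph) {j : ℕ}
    (hj : (pow A (j + 1)).domain = (pow A j).domain) {x : E} (hx : x ∈ M) : x ∈ A.domain := by
  -- That is, `A ^ n J ^ n y = y`. So `J ^ j x` lies in `D(A ^ j) = D(A ^ (j + 1))`, which says
  -- exactly that `x = A ^ j J ^ j x` is in `D(A)`.
  have key : ∀ n, ∀ y ∈ M, ((J ^ n) y, y) ∈ (pow A n).graph := by
    intro n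
    induction n with
    | zero => exact fun y _ => (LinearPMap.mem_graph_iff _).2 ⟨⟨y, trivial⟩, rfl, rfl⟩
    | succ n ih =>
      intro y hy
      have h := ih (J y) (hJM y hy)
      rw [← Module.End.mul_apply, ← pow_succ] at h
      exact mem_graph_pcomp h (hJ y hy)
  obtain ⟨w, hw1, hw2⟩ := (LinearPMap.mem_graph_iff _).1 (key j x hx)
  obtain ⟨h3, h4⟩ : (w : E) ∈ (pow A (j + 1)).domain := by rw [hj]; exact w.2
  have hw2' : pow A j w = x := hw2
  rwa [← hw2']

theorem exists_eq_ofMap {X : Type*} [NormedAddCommGroup X] [NormedSpace ℂ X] [CompleteSpace X]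
    {A : X →ₗ.[ℂ] X} (hcl : A.IsClosed) (hdom : A.domain = ⊤) :
    ∃ a : X →L[ℂ] X, A = ofMap (a : X →ₗ[ℂ] X) := by
  let f : X →ₗ[ℂ] X := A.toFun ∘ₗ (LinearMap.id.codRestrict A.domain fun x => by simp [hdom])
  have hf : ∀ x : A.domain, f x = A x := fun _ => rfl
  have hgr : (f.graph : Set (X × X)) = A.graph := by
    ext ⟨x, y⟩
    rw [SetLike.mem_coe, SetLike.mem_coe, LinearMap.mem_graph_iff, LinearPMap.mem_graph_iff]
    constructor
    · intro h
      exact ⟨⟨x, by simp [hdom]⟩, rfl, h.symm⟩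
    · rintro ⟨w, rfl, h⟩
      exact h.symm
  have hcl' : IsClosed (f.graph : Set (X × X)) := by rw [hgr]; exact hcl
  exact ⟨ContinuousLinearMap.ofIsClosedGraph hcl',
    linearPMap_eq_of_domain_eq_top hdom rfl fun x hx _ => (hf ⟨x, hx⟩).symm⟩

end Domain

/-! ### The bounded generator: spectral projection and Riesz part. -/

section Bounded

variable {X : Type*} [NormedAddCommGroup X] [NormedSpace ℂ X]

/-- Operators commuting with a semigroup commute with its bounded generator. -/
theorem commute_of_isGenerator {T : ℝ → X →L[ℂ] X} {a : X →L[ℂ] X}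
    (hgen : IsGenerator T (ofMap (a : X →ₗ[ℂ] X))) {B : X →L[ℂ] X}
    (hB : ∀ t : ℝ, 0 ≤ t → ∀ x, T t (B x) = B (T t x)) : Commute a B := by
  have hlim : ∀ x, Tendsto (fun t : ℝ => (t : ℂ)⁻¹ • (T t x - x)) (𝓝[>] 0) (𝓝 (a x)) := fun x =>
    (hgen x (a x)).1 ((LinearPMap.mem_graph_iff _).2 ⟨⟨x, trivial⟩, rfl, rfl⟩)
  refine ContinuousLinearMap.ext fun x => ?_
  refine tendsto_nhds_unique (hlim (B x)) (((B.continuous.tendsto _).comp (hlim x)).congr' ?_)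
  filter_upwards [self_mem_nhdsWithin] with t ht
  simp only [Function.comp_apply, map_smul, map_sub]
  rw [hB t (le_of_lt ht)]

/-- An operator invertible on the kernel of a projection `Q` with `a Q` Riesz is generalized
Drazin-Riesz invertible. -/
theorem isGDRInvertible_of_isRiesz {a Q : X →L[ℂ] X} (hQ : IsIdempotentElem Q)
    (haQ : Commute a Q) (h : InvOn a (1 - Q)) (hR : IsRiesz (a * Q)) :
    IsGDRInvertible (ofMap (a : X →ₗ[ℂ] X)) := by
  obtain ⟨d, h1, h2⟩ := h
  -- With `B = d (1 - Q)` one has `I - A B = Q`, so the Riesz part is `a Q`.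
  have hab : a * (d * (1 - Q)) = 1 - Q := by rw [← mul_assoc, h1, hQ.one_sub.eq]
  have hba : d * (1 - Q) * a = 1 - Q := by
    rw [mul_assoc, ← ((Commute.one_right a).sub_right haQ).eq, ← mul_assoc, h2, hQ.one_sub.eq]
  refine ⟨d * (1 - Q), fun _ => trivial, fun _ => trivial, fun x => ?_, fun x => ?_,
    a * Q, hR, fun x => ?_⟩
  · have : d * (1 - Q) * (a * (d * (1 - Q))) = d * (1 - Q) := by
      rw [hab, mul_assoc, hQ.one_sub.eq]
    exact congrArg (fun f : X →L[ℂ] X => f x) this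
  · exact congrArg (fun f : X →L[ℂ] X => f x.1) (hba.trans hab.symm)
  · have : a * Q = a * (1 - a * (d * (1 - Q))) := by rw [hab, sub_sub_cancel]
    exact congrArg (fun f : X →L[ℂ] X => f x) this

/-- Inverse of `a - ξ Q`. -/
theorem exists_isInverse_subMap {a Q : X →L[ℂ] X} (hQ : IsIdempotentElem Q)
    (haQ : Commute a Q) {ξ : ℂ} (h₁ : InvOn (a - ξ • 1) Q) (h₂ : InvOn a (1 - Q)) :
    ∃ C : X →L[ℂ] X,
      IsInverse (subMap (ofMap (a : X →ₗ[ℂ] X)) ((ξ • Q : X →L[ℂ] X) : X →ₗ[ℂ] X)) C ∧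
        C * (a - ξ • Q) = 1 := by
  have hu : IsUnit (a - ξ • Q) := by
    refine InvOn.isUnit_of_corners hQ h₁ h₂ (haQ.sub_left ((Commute.refl Q).smul_left ξ)) ?_ ?_
    · rw [sub_mul, sub_mul, smul_mul_assoc, smul_mul_assoc, hQ.eq, one_mul]
    · rw [sub_mul, smul_mul_assoc, mul_sub Q, mul_one, hQ.eq, sub_self, smul_zero, sub_zero]
  obtain ⟨C, hC1, hC2⟩ := isUnit_iff_exists.1 hu
  refine ⟨C, ?_, hC2⟩
  rw [subMap_ofMap]
  exact isInverse_ofMap hC1 hC2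

variable [CompleteSpace X]

/-- Splitting off finitely many Browder points from the range of `P`: the resulting projection `Q`
carries the part of the spectrum of `a` in a small disc around `0`. -/
theorem exists_projection_of_browder_sequence {a P : X →L[ℂ] X} (hP : IsIdempotentElem P)
    (haP : Commute a P) (h0 : InvOn a (1 - P)) {μ : ℕ → ℂ}
    (hspec : spec (mulBdd (ofMap (a : X →ₗ[ℂ] X)) P) = insert 0 (Set.range μ))
    (hbr : ∀ i, IsBrowder (shift (ofMap (a : X →ₗ[ℂ] X)) (μ i))) (hμ0 : ∀ i, μ i ≠ 0)
    (hμ : Tendsto μ atTop (𝓝 0)) :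
    ∃ (Q : X →L[ℂ] X) (r : ℝ), 0 < r ∧ IsIdempotentElem Q ∧ Commute a Q ∧ P * Q = Q ∧ Q * P = Q ∧
      (∀ z : ℂ, ‖z‖ < r → InvOn (a - z • 1) (1 - Q)) ∧
      (∀ z : ℂ, r ≤ ‖z‖ → InvOn (a - z • 1) Q) ∧
      (∀ z ∉ insert 0 (Set.range μ), InvOn (a - z • 1) Q) ∧
      ∀ᶠ i in atTop, ¬ InvOn (a - μ i • 1) Q := by
  have hPs : ∀ z : ℂ, z ≠ 0 → (z ∈ Set.range μ ↔ ¬ InvOn (a - z • 1) P) := fun z hz => by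
    rw [← isUnit_mul_sub_iff hP haP hz, ← notMem_spec_ofMap, not_not, ← mulBdd_ofMap, hspec,
      Set.mem_insert_iff, or_iff_right hz]
  have haP' : Commute a (1 - P) := (Commute.one_right a).sub_right haP
  -- This radius, on which `a - z` stays invertible on `N(P)`, decides which `μ i` are split off.
  obtain ⟨r, hr, hball⟩ := Metric.eventually_nhds_iff.1 (h0.eventually hP.one_sub haP')
  have hsmall : ∀ᶠ i in atTop, ‖μ i‖ < r := by
    have := hμ.norm
    rw [norm_zero] at this
    exact this.eventually_lt_const hr
  have hfin : {z | z ∈ Set.range μ ∧ r ≤ ‖z‖}.Finite := by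
    obtain ⟨N, hN⟩ := eventually_atTop.1 hsmall
    refine ((Set.finite_lt_nat N).image μ).subset ?_
    rintro _ ⟨⟨i, rfl⟩, hi⟩
    exact ⟨i, not_le.1 fun h => (hN i h).not_ge hi, rfl⟩
  have hF : ∀ z, z ∈ hfin.toFinset ↔ z ∈ Set.range μ ∧ r ≤ ‖z‖ := fun z => hfin.mem_toFinset
  obtain ⟨e, he, hec, he1, he2⟩ := exists_idempotent_of_finset (a := a) hfin.toFinset fun l hl => by
    obtain ⟨⟨i, rfl⟩, -⟩ := (hF l).1 hl
    exact hbr i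
  have hae : Commute a e := (hec a (Commute.refl a)).symm
  have heP : Commute e P := hec P haP
  have hae' : Commute a (1 - e) := (Commute.one_right a).sub_right hae
  have hPe' : Commute P (1 - e) := (Commute.one_right P).sub_right heP.symm
  have haQ : Commute a (P * (1 - e)) := haP.mul_right hae'
  have hQP : P * (P * (1 - e)) = P * (1 - e) := by rw [← mul_assoc, hP.eq]
  have hout : ∀ z ∉ insert 0 (Set.range μ), InvOn (a - z • 1) (P * (1 - e)) := by
    intro z hz
    rw [Set.mem_insert_iff, not_or] at hz
    have : InvOn (a - z • 1) P := not_not.1 fun h => hz.2 ((hPs z hz.1).2 h)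
    exact this.mono (commute_sub_smul_one haQ z).symm hQP
  refine ⟨P * (1 - e), r, hr, hP.mul_of_commute hPe' he.one_sub, haQ, hQP, ?_, ?_, ?_, hout, ?_⟩
  · rw [mul_assoc, ← hPe'.eq, ← mul_assoc, hP.eq]
  · intro z hz
    have h1 : InvOn (a - z • 1) (1 - P) := hball (by rwa [dist_zero_right])
    have h2 := (he1 z fun h => ((hF z).1 h).2.not_gt hz).mono (f := e * P)
      (commute_sub_smul_one (hae.mul_right haP) z).symm (by rw [← mul_assoc, he.eq])
    have : 1 - P * (1 - e) = 1 - P + e * P := by rw [heP.eq]; noncomm_ring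
    rw [this]
    exact h1.add h2
  · intro z hz
    by_cases hzμ : z ∈ Set.range μ
    · refine (he2 z ((hF z).2 ⟨hzμ, hz⟩)).mono (commute_sub_smul_one haQ z).symm ?_
      rw [hPe'.eq, ← mul_assoc, he.one_sub.eq]
    · refine hout z fun h => ?_
      rcases h with rfl | h
      · rw [norm_zero] at hz
        exact hz.not_gt hr
      · exact hzμ h
  -- A small `μ i` is not removed, so `a - μ i` is invertible on the range of `e P`; invertibility
  -- on `Q` as well would give it on `P`.
  · filter_upwards [hsmall] with i hi hQ
    refine (hPs (μ i) (hμ0 i)).1 ⟨i, rfl⟩ ?_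
    have h2 := (he1 (μ i) fun h => ((hF _).1 h).2.not_gt hi).mono (f := e * P)
      (commute_sub_smul_one (hae.mul_right haP) _).symm (by rw [← mul_assoc, he.eq])
    have : P = P * (1 - e) + e * P := by rw [heP.eq]; noncomm_ring
    rw [this]
    exact hQ.add h2

/-- The part of the spectrum in a disc is carried by `Q`, so `Q` is a spectral projection. -/
theorem isSpectralProjection_of_disc {a Q : X →L[ℂ] X} (hQ : IsIdempotentElem Q)
    (haQ : Commute a Q) {σ : Set ℂ} (hσc : IsCompact σ) (hσ : ∀ z, z ∉ σ ↔ InvOn (a - z • 1) Q)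
    {r : ℝ} (hσr : ∀ z ∈ σ, ‖z‖ < r) (hr : ∀ z : ℂ, ‖z‖ < r → InvOn (a - z • 1) (1 - Q)) :
    IsSpectralProjection (ofMap (a : X →ₗ[ℂ] X)) σ Q := by
  have hee : ∀ x, Q (Q x) = Q x := fun x => congrArg (fun f : X →L[ℂ] X => f x) hQ.eq
  have hcomm : ∀ x, a (Q x) = Q (a x) := fun x => congrArg (fun f : X →L[ℂ] X => f x) haQ.eq
  have hran : ∀ x, x ∈ LinearMap.range (Q : X →ₗ[ℂ] X) ↔ Q x = x := fun x => by
    refine ⟨?_, fun h => ⟨x, h⟩⟩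
    rintro ⟨y, rfl⟩
    exact hee y
  have hker : ∀ x, x ∈ LinearMap.ker (Q : X →ₗ[ℂ] X) ↔ (1 - Q) x = x := fun x => by
    change Q x = 0 ↔ x - Q x = x
    rw [sub_eq_self]
  have haQ' : Commute a (1 - Q) := (Commute.one_right a).sub_right haQ
  have hsub : σ ⊆ spec (ofMap (a : X →ₗ[ℂ] X)) := by
    intro z hz
    by_contra h
    rw [notMem_spec_ofMap] at h
    exact (hσ z).2 (IsUnit.invOn h (commute_sub_smul_one haQ z)) hz
  have hdisc : ∀ z ∈ spec (ofMap (a : X →ₗ[ℂ] X)), ‖z‖ < r → z ∈ σ := by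
    intro z hz hzr
    by_contra h
    exact (notMem_spec_ofMap a z).2 (((hσ z).1 h).isUnit (hr z hzr)) hz
  refine ⟨⟨hσc.isBounded, ?_, ?_, ?_⟩, hQ, ⟨?_, ?_, ?_, fun _ _ => trivial, ?_, ?_⟩, ?_, ?_⟩
  · rintro _ ⟨z, hz, rfl⟩
    exact Set.mem_insert_of_mem _ ⟨z, hsub hz, rfl⟩
  · exact (OnePoint.isClosed_image_coe.2 ⟨hσc.isClosed, hσc⟩).preimage continuous_subtype_val
  -- Inside the compactified spectrum, `σ` is the trace of the open disc, hence open; `∞` is not in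
  -- the image of the disc.
  · have : {z : extSpec (ofMap (a : X →ₗ[ℂ] X)) |
        (z : OnePoint ℂ) ∈ (fun z : ℂ => (z : OnePoint ℂ)) '' σ} =
        Subtype.val ⁻¹' ((fun z : ℂ => (z : OnePoint ℂ)) '' Metric.ball 0 r) := by
      ext ⟨w, hw⟩
      change w ∈ (fun z : ℂ => (z : OnePoint ℂ)) '' σ ↔
        w ∈ (fun z : ℂ => (z : OnePoint ℂ)) '' Metric.ball 0 r
      constructor
      · rintro ⟨z, hz, rfl⟩
        exact ⟨z, mem_ball_zero_iff.2 (hσr z hz), rfl⟩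
      · rintro ⟨z, hz, rfl⟩
        rcases hw with hw | ⟨z', hz', hw⟩
        · exact absurd hw (OnePoint.coe_ne_infty z)
        · obtain rfl : z' = z := OnePoint.coe_injective hw
          exact ⟨z', hdisc z' hz' (mem_ball_zero_iff.1 hz), rfl⟩
    rw [this]
    exact (OnePoint.isOpen_image_coe.2 Metric.isOpen_ball).preimage continuous_subtype_val
  · exact Q.isClosed_ker
  · have : (LinearMap.range (Q : X →ₗ[ℂ] X) : Set X) = {x | Q x = x} := Set.ext hran
    rw [this]
    exact isClosed_eq Q.continuous continuous_id
  · intro x hx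
    change Q (a x) = 0
    have hx' : Q x = 0 := hx
    rw [← hcomm, hx', map_zero]
  · intro x hx
    rw [hran] at hx ⊢
    change Q (a x) = a x
    rw [← hcomm, hx]
  · exact ((ContinuousLinearMap.IsIdempotentElem.isTopCompl hQ).isCompl).symm
  · ext z
    rw [← not_iff_not, notMem_spec_part hQ.one_sub haQ' hker, Set.mem_sdiff, not_and, not_not]
    constructor
    · intro h hz
      by_contra hz'
      exact (notMem_spec_ofMap a z).2 (((hσ z).1 hz').isUnit h) hz
    · intro h
      by_cases hzr : ‖z‖ < r
      · exact hr z hzr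
      · have hzs : z ∉ spec (ofMap (a : X →ₗ[ℂ] X)) := fun hz => hzr (hσr z (h hz))
        exact IsUnit.invOn ((notMem_spec_ofMap a z).1 hzs) (commute_sub_smul_one haQ' z)
  · ext z
    rw [← not_iff_not, notMem_spec_part hQ haQ hran, hσ]

/-- A Browder point in the spectrum on the range of `Q` is an eigenvalue of `a Q`. -/
theorem exists_eigenvector_of_isBrowder {a Q : X →L[ℂ] X} (hQ : IsIdempotentElem Q)
    (haQ : Commute a Q) {l : ℂ} (hbr : IsBrowder (shift (ofMap (a : X →ₗ[ℂ] X)) l))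
    (h : ¬ InvOn (a - l • 1) Q) : ∃ x ≠ 0, (a * Q) x = l • x := by
  by_contra! hne
  obtain ⟨g, k, hg, hgc, hg1, hg2⟩ := exists_idempotent_of_isBrowder hbr
  have hsQ := commute_sub_smul_one haQ l
  have hinj : ∀ (n : ℕ) (x : X), Q x = x → ((a - l • 1) ^ n) x = 0 → x = 0 := by
    intro n
    induction n with
    | zero => exact fun x _ hx => hx
    | succ n ih =>
      intro x hx h0
      rw [pow_succ] at h0
      have h1 : (a - l • 1) x = 0 := by
        refine ih _ ?_ h0
        have := congrArg (fun f : X →L[ℂ] X => f x) hsQ.eq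
        change (a - l • 1) (Q x) = Q ((a - l • 1) x) at this
        rw [← this, hx]
      by_contra hx0
      refine hne x hx0 ?_
      change a (Q x) = l • x
      rw [hx]
      exact sub_eq_zero.1 h1
  have hgQ : Commute g Q := hgc Q haQ
  -- Without eigenvectors `a - l` has injective powers on the range of `Q`, while one of them kills
  -- the range of `g`. So `Q` lies under `1 - g`, where `a - l` is invertible.
  have hzero : g * Q = 0 := by
    refine ContinuousLinearMap.ext fun x => hinj k _ ?_ ?_
    · have : Q * (g * Q) = g * Q := by rw [hgQ.eq, ← mul_assoc, hQ.eq]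
      exact congrArg (fun f : X →L[ℂ] X => f x) this
    · exact congrArg (fun f : X →L[ℂ] X => f (Q x)) hg1
  exact h (hg2.mono hsQ.symm (by rw [sub_mul, one_mul, hzero, sub_zero]))

/-- If the spectrum of `a` on the range of `Q` consists of Browder points accumulating at `0`
only, then `a Q` is a Riesz operator. -/
theorem isRiesz_mul {a Q : X →L[ℂ] X} (hQ : IsIdempotentElem Q) (haQ : Commute a Q) {μ : ℕ → ℂ}
    (hbr : ∀ i, IsBrowder (shift (ofMap (a : X →ₗ[ℂ] X)) (μ i))) (hμ0 : ∀ i, μ i ≠ 0)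
    (hμ : Tendsto μ atTop (𝓝 0)) (hout : ∀ z ∉ insert 0 (Set.range μ), InvOn (a - z • 1) Q)
    (hin : ∀ᶠ i in atTop, ¬ InvOn (a - μ i • 1) Q) : IsRiesz (a * Q) := by
  ext z
  rw [Set.mem_singleton_iff, essSpec, Set.mem_ofPred_eq]
  constructor
  · contrapose!
    intro hz
    by_cases hzμ : z ∈ Set.range μ
    · obtain ⟨i, rfl⟩ := hzμ
      exact isFredholm_mul_sub hQ haQ hz (hbr i).1
    · rw [shift_ofMap_coe]
      refine isFredholm_of_isUnit ((isUnit_mul_sub_iff hQ haQ hz).2 (hout z ?_))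
      rintro (h | h)
      exacts [hz h, hzμ h]
  · rintro rfl
    rw [shift_ofMap_coe, zero_smul, sub_zero]
    refine not_isFredholm_of_frequently ?_ ?_
    -- A countable set has dense complement, so points where `a Q - z` is invertible accumulate at
    -- `0`.
    · have hd : Dense (insert 0 (Set.range μ))ᶜ :=
        Set.Countable.dense_compl ℂ ((Set.countable_range μ).insert 0)
      refine (mem_closure_iff_frequently.1 (hd 0)).mono fun z hz => ?_
      have hz0 : z ≠ 0 := fun h => hz (Or.inl h)
      exact (ContinuousLinearMap.isUnit_iff_bijective.1
        ((isUnit_mul_sub_iff hQ haQ hz0).2 (hout z hz))).1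
    · refine hμ.frequently (Eventually.frequently ?_)
      filter_upwards [hin] with i hi
      exact ⟨hμ0 i, exists_eigenvector_of_isBrowder hQ haQ (hbr i) hi⟩

end Bounded

end DrazinRiesz

/-! ### Assembly of the theorem. -/

open DrazinRiesz
theorem mainTheorem2 {X : Type*} [NormedAddCommGroup X] [NormedSpace ℂ X] [CompleteSpace X]
    (hX : ¬ FiniteDimensional ℂ X)
    (T : ℝ → X →L[ℂ] X) (hT : IsC0Semigroup T) (hTb : ∃ K : ℝ, ∀ t : ℝ, 0 ≤ t → ‖T t‖ ≤ K)
    (A : X →ₗ.[ℂ] X) (hA : IsHatClosed A) (hgen : IsGenerator T A)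
    (hacc : AccPt (0 : ℂ) (𝓟 (spec A)))
    (P : X →L[ℂ] X) (hP : IsIdempotentElem P) (hP0 : P ≠ 0)
    (hcomm : ∀ t : ℝ, 0 ≤ t → (T t).comp P = P.comp (T t))
    (hran : ∀ x : X, P x ∈ A.domain)
    (hlim : Tendsto (fun t : ℝ => ‖(T t).comp (ContinuousLinearMap.id ℂ X - P)‖) atTop (𝓝 0))
    (μ : ℕ → ℂ) (hspec : spec (mulBdd A P) = insert 0 (Set.range μ))
    (hμ : ∀ i, μ i ∈ rieszPoints A \ {0}) (hμlim : Tendsto μ atTop (𝓝 0))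
    (hμanti : Antitone fun i => ‖μ i‖) (hμ0 : ‖μ 0‖ < 1 / 2) :
    IsGDRInvertible A ∧
    ∃ Q : X →L[ℂ] X, IsSpectralProjection A (spec (mulBdd A Q)) Q ∧
    ∃ D : X →L[ℂ] X, IsDrazinInverse A (spec (mulBdd A Q)) D ∧
    ∃ C : X →L[ℂ] X, IsInverse (subMap A (P : X →ₗ[ℂ] X)) C ∧
    (∃ M ν : ℝ, 0 < M ∧ 0 < ν ∧ ∀ t : ℝ, 0 ≤ t →
      ‖(T t).comp (ContinuousLinearMap.id ℂ X - P)‖ ≤ M * Real.exp (-ν * t)) ∧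
    D.comp (ContinuousLinearMap.id ℂ X - P) = C.comp (ContinuousLinearMap.id ℂ X - P) ∧
    ∀ x : X, IntegrableOn (fun t : ℝ => T t (x - P x)) (Set.Ioi 0) ∧
      C (x - P x) = - ∫ t in Set.Ioi (0 : ℝ), T t (x - P x) := by
  obtain ⟨K, hK⟩ := hTb
  have hPP : ∀ x, P (P x) = P x := fun x => congrArg (fun f : X →L[ℂ] X => f x) hP.eq
  have hTP : ∀ t : ℝ, 0 ≤ t → ∀ x, T t (P x) = P (T t x) := fun t ht x =>
    congrArg (fun f : X →L[ℂ] X => f x) (hcomm t ht)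
  have hTadd : ∀ s t : ℝ, 0 ≤ s → 0 ≤ t → ∀ x, T (s + t) x = T s (T t x) := fun s t hs ht x =>
    congrArg (fun f : X →L[ℂ] X => f x) (hT.add s t hs ht)
  -- exponential decay on the kernel of `P`
  have hSadd : ∀ s t : ℝ, 0 ≤ s → 0 ≤ t →
      (T (s + t)).comp (ContinuousLinearMap.id ℂ X - P) =
        ((T s).comp (ContinuousLinearMap.id ℂ X - P)).comp
          ((T t).comp (ContinuousLinearMap.id ℂ X - P)) := by
    intro s t hs ht
    ext x
    change T (s + t) (x - P x) = T s (T t (x - P x) - P (T t (x - P x)))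
    rw [hTadd s t hs ht, ← hTP t ht, map_sub P, hPP, sub_self, map_zero, sub_zero]
  have hSK : ∀ t : ℝ, 0 ≤ t → ‖(T t).comp (ContinuousLinearMap.id ℂ X - P)‖ ≤
      K * ‖ContinuousLinearMap.id ℂ X - P‖ := fun t ht =>
    ((T t).opNorm_comp_le _).trans (mul_le_mul_of_nonneg_right (hK t ht) (norm_nonneg _))
  obtain ⟨M, ν, hM, hν, hdecay⟩ := exists_exp_bound hSadd hSK hlim
  -- the integrated semigroup inverts the generator on the kernel of `P`
  obtain ⟨hintegr, J, hJ⟩ := exists_integral_operator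
    (S := fun t => (T t).comp (ContinuousLinearMap.id ℂ X - P))
    (fun x => hT.continuousOn hK (x - P x)) hν hdecay
  have hintegr' : ∀ x, IntegrableOn (fun t : ℝ => T t (x - P x)) (Set.Ioi 0) := hintegr
  have hJ' : ∀ x, J x = ∫ t in Set.Ioi (0 : ℝ), T t (x - P x) := hJ
  have hgraph : ∀ x, (J x, -(x - P x)) ∈ A.graph := fun x => by
    rw [hJ']
    exact integral_orbit_mem_graph hT hgen (hT.continuousOn hK _) (hintegr' x)
  have hJT : ∀ t : ℝ, 0 ≤ t → ∀ x, T t (J x) = J (T t x) := fun t ht x => by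
    rw [hJ', hJ', ← ContinuousLinearMap.integral_comp_comm _ (hintegr' x)]
    refine setIntegral_congr_fun measurableSet_Ioi fun s hs => ?_
    have hs' : (0 : ℝ) ≤ s := le_of_lt hs
    change T t (T s (x - P x)) = T s (T t x - P (T t x))
    rw [← hTP t ht, ← map_sub, ← hTadd t s ht hs', ← hTadd s t hs' ht, add_comm]
  have hPJ : ∀ x, P (J x) = 0 := fun x => by
    rw [hJ', ← ContinuousLinearMap.integral_comp_comm _ (hintegr' x)]
    refine (setIntegral_congr_fun measurableSet_Ioi fun s hs => ?_).trans
      (integral_zero ℝ X)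
    change P (T s (x - P x)) = 0
    rw [← hTP s (le_of_lt hs), map_sub, hPP, sub_self, map_zero]
  -- the generator is bounded
  have hdom : A.domain = ⊤ := by
    obtain ⟨j, hj⟩ := hA.domains.exists
    rw [eq_top_iff]
    intro x _
    have hker : x - P x ∈ LinearMap.ker (P : X →ₗ[ℂ] X) := by
      change P (x - P x) = 0
      rw [map_sub, hPP, sub_self]
    have h1 : x - P x ∈ A.domain := by
      refine mem_domain_of_pow_domain_eq (J := ((-J : X →L[ℂ] X) : X →ₗ[ℂ] X)) (fun y _ => ?_)
        (fun y hy => ?_) hj hker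
      · change P (-J y) = 0
        rw [map_neg, hPJ, neg_zero]
      · have hy' : P y = 0 := hy
        have := A.graph.neg_mem (hgraph y)
        rw [hy', sub_zero, Prod.neg_mk, neg_neg] at this
        exact this
    simpa using A.domain.add_mem h1 (hran x)
  obtain ⟨a, rfl⟩ := exists_eq_ofMap hA.closed hdom
  have haP : Commute a P := commute_of_isGenerator hgen hTP
  have haJ : Commute a J := commute_of_isGenerator hgen hJT
  have haG : a * -J = 1 - P := by
    ext x
    obtain ⟨w, hw1, hw2⟩ := (LinearPMap.mem_graph_iff _).1 (hgraph x)
    change a (-J x) = x - P x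
    have hw1' : (w : X) = J x := hw1
    have hw2' : a w = -(x - P x) := hw2
    rw [map_neg, ← hw1', hw2', neg_neg]
  have hinv : InvOn a (1 - P) := ⟨-J, haG, by rw [← haG, haJ.neg_right.eq]⟩
  have hbr : ∀ i, IsBrowder (shift (ofMap (a : X →ₗ[ℂ] X)) (μ i)) := fun i =>
    not_not.1 (hμ i).1.2
  have hμne : ∀ i, μ i ≠ 0 := fun i => (hμ i).2
  obtain ⟨Q, r, hr, hQ, haQ, hPQ, hQP, hQker, hQout, hQspec, hQin⟩ :=
    exists_projection_of_browder_sequence hP haP hinv hspec hbr hμne hμlim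
  have hσ : spec (mulBdd (ofMap (a : X →ₗ[ℂ] X)) Q) = spectrum ℂ (a * Q) := by
    rw [mulBdd_ofMap, spec_ofMap]
  have hσne : ∀ z ≠ 0, (z ∉ spec (mulBdd (ofMap (a : X →ₗ[ℂ] X)) Q) ↔ InvOn (a - z • 1) Q) :=
    fun z hz => by rw [mulBdd_ofMap, notMem_spec_ofMap, isUnit_mul_sub_iff hQ haQ hz]
  have hσc : IsCompact (spec (mulBdd (ofMap (a : X →ₗ[ℂ] X)) Q)) := by
    rw [hσ]; exact spectrum.isCompact _
  -- `0` is a limit of the `μ i` that remain in this closed spectrum.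
  have h0σ : (0 : ℂ) ∈ spec (mulBdd (ofMap (a : X →ₗ[ℂ] X)) Q) := by
    refine hσc.isClosed.mem_of_tendsto hμlim ?_
    filter_upwards [hQin] with i hi
    by_contra h
    exact hi ((hσne _ (hμne i)).1 h)
  -- The corner criterion for `σ(a Q)` excludes `z = 0`; here invertibility at `0` would persist
  -- nearby and contradict the `μ i`.
  have h0Q : ¬ InvOn (a - (0 : ℂ) • 1) Q := fun h => by
    rw [zero_smul, sub_zero] at h
    obtain ⟨i, h1, h2⟩ := (hQin.and (hμlim.eventually (h.eventually hQ haQ))).exists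
    exact h1 h2
  have hσiff : ∀ z, z ∉ spec (mulBdd (ofMap (a : X →ₗ[ℂ] X)) Q) ↔ InvOn (a - z • 1) Q := by
    intro z
    rcases eq_or_ne z 0 with rfl | hz
    · exact iff_of_false (not_not.2 h0σ) h0Q
    · exact hσne z hz
  have hσr : ∀ z ∈ spec (mulBdd (ofMap (a : X →ₗ[ℂ] X)) Q), ‖z‖ < r := fun z hz => by
    by_contra h
    exact (hσiff z).2 (hQout z (not_lt.1 h)) hz
  have hsp := isSpectralProjection_of_disc hQ haQ hσc hσiff hσr hQker
  have hQinv : InvOn a (1 - Q) := by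
    have := hQker 0 (by rwa [norm_zero])
    rwa [zero_smul, sub_zero] at this
  -- the inverses of `a - ξ Q` and `a - P`
  have hξ : ‖((2 * r + 1 : ℝ) : ℂ)‖ = 2 * r + 1 := by
    rw [Complex.norm_real, Real.norm_of_nonneg (by positivity)]
  obtain ⟨Cξ, hCξ, hCξ'⟩ := exists_isInverse_subMap hQ haQ
    (hQout ((2 * r + 1 : ℝ) : ℂ) (by rw [hξ]; linarith)) hQinv
  -- The bounds `|μ i| ≤ |μ 0| < 1/2` keep `1` out of `σ(a P)`.
  have h1P : InvOn (a - (1 : ℂ) • 1) P := by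
    rw [← isUnit_mul_sub_iff hP haP one_ne_zero, ← notMem_spec_ofMap, ← mulBdd_ofMap, hspec]
    rintro (h | ⟨i, hi⟩)
    · exact one_ne_zero h
    · have h1 : ‖μ i‖ ≤ ‖μ 0‖ := hμanti (Nat.zero_le i)
      rw [hi, norm_one] at h1
      linarith
  obtain ⟨C, hC, hC'⟩ := exists_isInverse_subMap hP haP h1P hinv
  rw [one_smul] at hC hC'
  have hPJ' : P * -J = 0 := by
    ext x
    change P (-J x) = 0
    rw [map_neg, hPJ, neg_zero]
  have hQJ : Q * -J = 0 := by rw [← hQP, mul_assoc, hPJ', mul_zero]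
  -- Since `P J = 0`, also `(a - P)(-J) = 1 - P`; cancelling `a - P` on the left gives the formula,
  -- and the same works below for `a - ξ Q`.
  have hCG : C * (1 - P) = -J := by
    have : (a - P) * -J = 1 - P := by rw [sub_mul, haG, hPJ', sub_zero]
    rw [← this, ← mul_assoc, hC', one_mul]
  have hDG : Cξ * (1 - Q) * (1 - P) = -J := by
    have h1 : (1 - Q) * (1 - P) = 1 - P := by
      rw [sub_mul, one_mul, mul_sub, mul_one, hQP, sub_self, sub_zero]
    have h2 : (a - ((2 * r + 1 : ℝ) : ℂ) • Q) * -J = 1 - P := by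
      rw [sub_mul, haG, smul_mul_assoc, hQJ, smul_zero, sub_zero]
    rw [mul_assoc, h1, ← h2, ← mul_assoc, hCξ', one_mul]
  refine ⟨isGDRInvertible_of_isRiesz hQ haQ hQinv
      (isRiesz_mul hQ haQ hbr hμne hμlim hQspec hQin),
    Q, hsp, Cξ * (1 - Q), ⟨?_, h0σ, Q, hsp, ((2 * r + 1 : ℝ) : ℂ), ?_, Cξ, hCξ, rfl⟩, C, hC,
    ⟨M, ν, hM, hν, hdecay⟩, hDG.trans hCG.symm, fun x => ⟨hintegr' x, ?_⟩⟩
  · obtain ⟨z, hz, hz'⟩ := hsp.spectralSet.2.1 ⟨0, h0σ, rfl⟩ |>.resolve_left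
      (OnePoint.coe_ne_infty 0)
    rwa [← OnePoint.coe_injective hz']
  · rw [hξ]
    have : sSup ((fun z : ℂ => ‖z‖) '' spec (mulBdd (ofMap (a : X →ₗ[ℂ] X)) Q)) ≤ r := by
      refine csSup_le ⟨_, 0, h0σ, rfl⟩ ?_
      rintro _ ⟨z, hz, rfl⟩
      exact (hσr z hz).le
    linarith
  · rw [← hJ']
    exact congrArg (fun f : X →L[ℂ] X => f x) hCG
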